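/- **Setting.** Let $\mathscr X=\mathbb Z_{\ge 0}$, and let $\mathscr U$ be the set of all finite (possibly empty) increasing sequences of time points in $\mathbb R_{\ge0}$, regarded as finite sets; $\mathscr U_{<t}$ is the set of those $u\in\mathscr U$ all of whose time points are $<t$. For $u\in\mathscr U$ let $\mathscr X_u$ be the set of non-decreasing tuples $x_u=(x_s)_{s\in u}$ in $\mathscr X$. Let $\Omega$ be a set of paths $\omega:\mathbb R_{\ge0}\to\mathbb Z_{\ge0}$ such that every $\omega\in\Omega$ is non-decreasing and such that for every non-empty $u\in\mathscr U$ and every $x_u\in\mathscr X_u$ there is an $\omega\in\Omega$ with $\omega(s)=x_s$ for all $s\in u$. For $v\in\mathscr U$ and $B\subseteq\mathscr X_v$ write $(X_v\in B)=\{\omega\in\Omega:(\omega(s))_{s\in v}\in B\}$; in particular $(X_\emptyset=x_\emptyset)=\Omega$. Let $\mathcal F_u$ be the field (algebra of subsets of $\Omega$) generated by the events $(X_v\in B)$ with $B\subseteq\mathscr X_v$ and $v\subseteq u\cup[\max u,+\infty)$ (no restriction on $v$ if $u=\emptyset$), and let $$\mathcal D_{\mathrm{CP}}=\{(A,\,X_u=x_u):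 u\in\mathscr U,\ A\in\mathcal F_u,\ x_u\in\mathscr X_u\}.$$ A *full conditional probability* on a non-empty set $S$ is a real map $P(A\mid C)$, defined for all $A\subseteq S$ and all non-empty $C\subseteq S$, such that for all $A,B\subseteq S$ and all non-empty $C,D\subseteq S$: $P(A\mid C)\ge0$; $P(A\mid C)=1$ if $C\subseteq A$; $P(A\cup B\mid C)=P(A\mid C)+P(B\mid C)$ if $A\cap B=\emptyset$; and $P(A\cap D\mid C)=P(A\mid D\cap C)\,P(D\mid C)$ if $D\cap C\ne\emptyset$. A real map on a set of pairs $(A,C)$ with $A,C\subseteq S$ and $C\neq\emptyset$ is a *coherent conditional probability* if it extends to a full conditional probability on $S$. A *counting process* is a coherent conditional probability $P$ on $\mathcal D_{\mathrm{CP}}$ such that * (CP1) $P(X_0=0\mid\Omega)=1$; * (CP2) for all $t\ge0$, $u\in\mathscr U_{<t}$ and $(x_u,x)\in\mathscr X_{u\cup\{t\}}$, $\lim_{\Delta\to0^+}\frac1\Delta P(X_{t+\Delta}\ge x+2\mid X_u=x_u,X_t=x)=0$ and, if $t>0$, $\lim_{\Delta\to0^+}\frac1\Delta P(X_t\ge x+2\mid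 X_u=x_u,X_{t-\Delta}=x)=0$. A *Poisson process* is a counting process $P$ such that for all $t,\Delta\ge0$, $u\in\mathscr U_{<t}$, $(x_u,x)\in\mathscr X_{u\cup\{t\}}$ and $y\in\mathscr X$ with $y\ge x$: $P(X_{t+\Delta}=y\mid X_u=x_u,X_t=x)=P(X_{t+\Delta}=y\mid X_t=x)$, $P(X_{t+\Delta}=y\mid X_t=x)=P(X_{t+\Delta}=y-x\mid X_t=0)$, and $P(X_{t+\Delta}=y\mid X_t=x)=P(X_\Delta=y\mid X_0=x)$. **Theorem.** (i) For every Poisson process $P$ there is a rate $\lambda\ge0$ such that for all $t,\Delta\ge0$, $u\in\mathscr U_{<t}$, $(x_u,x)\in\mathscr X_{u\cup\{t\}}$ and $y\in\mathscr X$, $$P(X_{t+\Delta}=y\mid X_u=x_u,X_t=x)=\begin{cases}\psi_{\lambda\Delta}(y-x)&\text{if }y\ge x,\\0&\text{otherwise,}\end{cases}\qquad \psi_{\mu}(k)=e^{-\mu}\frac{\mu^k}{k!}\quad(0^0=1).\tag{$*$}$$ (ii) Conversely, for every $\lambda\ge0$ there is a unique coherent conditional probability $P$ on $\mathcal D_{\mathrm{CP}}$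 that satisfies (CP1) and $(*)$, and this $P$ is a Poisson process. -/

import Mathlib

open Set Filter Topology
open scoped NNReal

namespace CountingProcess

/-! ### Full and coherent conditional probabilities on an arbitrary sample space -/

/-- `P A C`, read `P(A | C)`, is a full conditional probability on the sample space `S`: it is only
constrained (and only meaningful) for non-empty conditioning events `C`. -/
structure IsFullCondProb {S : Type*} (P : Set S → Set S → ℝ) : Prop where
  nonneg : ∀ A C : Set S, C.Nonempty → 0 ≤ P A C
  eq_one : ∀ A C : Set S, C.Nonempty → C ⊆ A → P A C = 1
  additive : ∀ A B C : Set S, C.Nonempty → A ∩ B = ∅ → P (A ∪ B) C = P A C + P B C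
  bayes : ∀ A C D : Set S, C.Nonempty → D.Nonempty → (D ∩ C).Nonempty →
    P (A ∩ D) C = P A (D ∩ C) * P D C

/-- A real-valued map `P` on a domain `D` of pairs (event, non-empty event) is a coherent
conditional probability if it can be extended to a full conditional probability. -/
def IsCoherent {S : Type*} (D : Set (Set S × Set S)) (P : D → ℝ) : Prop :=
  (∀ d ∈ D, d.2.Nonempty) ∧
    ∃ Q : Set S → Set S → ℝ, IsFullCondProb Q ∧ ∀ d : D, Q d.1.1 d.1.2 = P d

/-! ### Counting paths and finitary events

Finite increasing sequences of time points are finite sets of non-negative reals; a tuple indexed by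
such a sequence `u` is a function `u → ℕ`. -/

/-- The non-decreasing tuples of counts indexed by the time points in `u`. -/
def States (u : Finset ℝ≥0) : Set (u → ℕ) := {x | Monotone x}

/-- The requirements on the set `Ω` of counting paths: all paths are non-decreasing, and every
non-decreasing finite instantiation is realised by some path. -/
structure IsPathSpace (Ω : Set (ℝ≥0 → ℕ)) : Prop where
  le_add : ∀ ω ∈ Ω, ∀ t Δ : ℝ≥0, ω t ≤ ω (t + Δ)
  exists_path : ∀ u : Finset ℝ≥0, u.Nonempty → ∀ x ∈ States u, ∃ ω ∈ Ω, ∀ t : u, ω t = x t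

variable {Ω : Set (ℝ≥0 → ℕ)}

/-- The finitary event `(X_v ∈ B)`. -/
def finitary (Ω : Set (ℝ≥0 → ℕ)) (v : Finset ℝ≥0) (B : Set (v → ℕ)) : Set Ω :=
  {ω | (fun t : v => ω.1 t) ∈ B}

/-- The event `(X_u = x)`; it is the whole of `Ω` if `u = ∅`. -/
def history (Ω : Set (ℝ≥0 → ℕ)) (u : Finset ℝ≥0) (x : u → ℕ) : Set Ω := finitary Ω u {x}

/-- The event `(X_t ∈ B)` for a single time point `t`. -/
def eventAt (Ω : Set (ℝ≥0 → ℕ)) (t : ℝ≥0) (B : Set ℕ) : Set Ω := {ω | ω.1 t ∈ B}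

/-- The field of events generated by the finitary events whose time points belong to `u` or
do not precede `max u` (no restriction if `u = ∅`). -/
def field (Ω : Set (ℝ≥0 → ℕ)) (u : Finset ℝ≥0) : Set (Set Ω) :=
  MeasureTheory.generateSetAlgebra
    {A | ∃ (v : Finset ℝ≥0) (B : Set (v → ℕ)), B ⊆ States v ∧
      (∀ t ∈ v, t ∈ u ∨ ∀ s ∈ u, s ≤ t) ∧ A = finitary Ω v B}

/-- The domain of a counting process: the pairs `(A, X_u = x_u)` with `A` in the field of `u`. -/
def domain (Ω : Set (ℝ≥0 → ℕ)) : Set (Set Ω × Set Ω) :=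
  {d | ∃ (u : Finset ℝ≥0) (x : u → ℕ), x ∈ States u ∧ d.1 ∈ field Ω u ∧ d.2 = history Ω u x}

/-! ### Counting processes and Poisson processes -/

open Classical in
/-- The value `P(A | C)` of a map `P` on the domain. The value `0` outside the domain plays no role:
all evaluations below lie in the domain (for the limit from the left, as soon as `Δ` is small). -/
noncomputable def pr (P : domain Ω → ℝ) (A C : Set Ω) : ℝ :=
  if h : (A, C) ∈ domain Ω then P ⟨(A, C), h⟩ else 0

/-- The event `(X_u = x_u, X_t = x)`. -/
def cond (Ω : Set (ℝ≥0 → ℕ)) (u : Finset ℝ≥0) (xu : u → ℕ) (t : ℝ≥0) (x : ℕ) : Set Ω :=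
  history Ω u xu ∩ eventAt Ω t {x}

/-- For a sequence `u` that precedes `t`: the tuple `(x_u, x)` indexed by `u ∪ {t}` is
non-decreasing. -/
def Admissible (u : Finset ℝ≥0) (xu : u → ℕ) (x : ℕ) : Prop :=
  xu ∈ States u ∧ ∀ s : u, xu s ≤ x

/-- The event `(X_s ∈ B)` belongs to the field of `u` if `s` does not precede `max u`. -/
theorem eventAt_mem_field (hΩ : IsPathSpace Ω) {u : Finset ℝ≥0} {s : ℝ≥0}
    (hs : ∀ r ∈ u, r ≤ s) (B : Set ℕ) : eventAt Ω s B ∈ field Ω u := by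
  refine MeasureTheory.self_subset_generateSetAlgebra
    ⟨{s}, {z | z ⟨s, Finset.mem_singleton_self s⟩ ∈ B} ∩ States {s}, inter_subset_right, ?_, ?_⟩
  · intro t ht
    rw [Finset.mem_singleton] at ht
    subst ht
    exact Or.inr hs
  · ext ω
    simp only [eventAt, finitary, mem_ofPred_eq, mem_inter_iff, States]
    refine ⟨fun h => ⟨h, ?_⟩, fun h => h.1⟩
    intro a b hab
    have h1 := hΩ.le_add ω.1 ω.2 a.1 (b.1 - a.1)
    rwa [add_tsub_cancel_of_le (show a.1 ≤ b.1 from hab)] at h1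

/-- The pairs `((X_s ∈ B), (X_u = x_u, X_t = x))` used below belong to the domain. -/
theorem cond_mem_domain (hΩ : IsPathSpace Ω) {u : Finset ℝ≥0} {xu : u → ℕ} {t s : ℝ≥0} {x : ℕ}
    (hu : ∀ r ∈ u, r < t) (hx : Admissible u xu x) (hs : t ≤ s) (B : Set ℕ) :
    (eventAt Ω s B, cond Ω u xu t x) ∈ domain Ω := by
  classical
  refine ⟨insert t u, fun r => if h : r.1 ∈ u then xu ⟨r.1, h⟩ else x, ?_, ?_, ?_⟩
  · intro a b hab
    have hab' : a.1 ≤ b.1 := hab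
    have hb := Finset.mem_insert.1 b.2
    by_cases h1 : a.1 ∈ u <;> by_cases h2 : b.1 ∈ u
    · simp only [h1, h2, dite_true]
      exact hx.1 hab'
    · simp only [h1, h2, dite_true, dite_false]
      exact hx.2 _
    · have ha := (Finset.mem_insert.1 a.2).resolve_right h1
      exact absurd (hu _ h2) (not_lt.2 (ha.symm.le.trans hab'))
    · simp only [h1, h2, dite_false, le_refl]
  · refine eventAt_mem_field hΩ (fun r hr => ?_) B
    rcases Finset.mem_insert.1 hr with rfl | hr
    · exact hs
    · exact (hu r hr).le.trans hs
  · have ht : t ∉ u := fun h => lt_irrefl _ (hu t h)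
    ext ω
    simp only [cond, history, finitary, eventAt, mem_inter_iff, mem_ofPred_eq, mem_singleton_iff]
    constructor
    · rintro ⟨h1, h2⟩
      funext r
      by_cases h : r.1 ∈ u
      · simpa only [h, dite_true] using congrFun h1 ⟨r.1, h⟩
      · have hr := (Finset.mem_insert.1 r.2).resolve_right h
        simp only [h, dite_false]
        rw [hr, h2]
    · intro h
      refine ⟨?_, ?_⟩
      · funext r
        simpa only [r.2, dite_true] using congrFun h ⟨r.1, Finset.mem_insert_of_mem r.2⟩
      · simpa only [ht, dite_false] using congrFun h ⟨t, Finset.mem_insert_self t u⟩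

/-- With the empty history, `cond` is the event `(X_t = x)`. -/
theorem cond_empty (xu : (∅ : Finset ℝ≥0) → ℕ) (t : ℝ≥0) (x : ℕ) :
    cond Ω ∅ xu t x = eventAt Ω t {x} := by
  have h : history Ω ∅ xu = univ :=
    eq_univ_of_forall fun _ => funext fun r => absurd r.2 (Finset.notMem_empty _)
  rw [cond, h, univ_inter]

/-- The pairs `((X_s ∈ B), Ω)` belong to the domain. -/
theorem univ_mem_domain (hΩ : IsPathSpace Ω) (s : ℝ≥0) (B : Set ℕ) :
    (eventAt Ω s B, (univ : Set Ω)) ∈ domain Ω :=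
  ⟨∅, fun _ => 0, fun _ _ _ => le_rfl,
    eventAt_mem_field hΩ (fun r hr => absurd hr (Finset.notMem_empty r)) B,
    (eq_univ_of_forall fun _ => funext fun r => absurd r.2 (Finset.notMem_empty _)).symm⟩

/-- `P(X_0 = 0) = 1`, where an unconditional probability is a probability given `Ω`. -/
def StartsAtZero (P : domain Ω → ℝ) : Prop := pr P (eventAt Ω 0 {0}) univ = 1

/-- Orderliness: the probability of two or more events in a short time interval vanishes
faster than the length of the interval. -/
def IsOrderly (P : domain Ω → ℝ) : Prop :=
  ∀ (t : ℝ≥0) (u : Finset ℝ≥0) (xu : u → ℕ) (x : ℕ), (∀ s ∈ u, s < t) → Admissible u xu x →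
    Tendsto (fun Δ : ℝ≥0 => pr P (eventAt Ω (t + Δ) (Ici (x + 2))) (cond Ω u xu t x) / (Δ : ℝ))
      (𝓝[>] 0) (𝓝 0) ∧
    (0 < t →
      Tendsto (fun Δ : ℝ≥0 => pr P (eventAt Ω t (Ici (x + 2))) (cond Ω u xu (t - Δ) x) / (Δ : ℝ))
        (𝓝[>] 0) (𝓝 0))

/-- A counting process. -/
structure IsCountingProcess (P : domain Ω → ℝ) : Prop where
  coherent : IsCoherent (domain Ω) P
  start : StartsAtZero P
  orderly : IsOrderly P

/-- A Poisson process: a counting process that is Markovian, state-homogeneous and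
time-homogeneous. -/
structure IsPoissonProcess (P : domain Ω → ℝ) : Prop extends IsCountingProcess P where
  markov : ∀ (t Δ : ℝ≥0) (u : Finset ℝ≥0) (xu : u → ℕ) (x y : ℕ), (∀ s ∈ u, s < t) →
    Admissible u xu x → x ≤ y →
    pr P (eventAt Ω (t + Δ) {y}) (cond Ω u xu t x) = pr P (eventAt Ω (t + Δ) {y}) (eventAt Ω t {x})
  state_homogeneous : ∀ (t Δ : ℝ≥0) (x y : ℕ), x ≤ y →
    pr P (eventAt Ω (t + Δ) {y}) (eventAt Ω t {x}) = pr P (eventAt Ω (t + Δ) {y - x}) (eventAt Ω t {0})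
  time_homogeneous : ∀ (t Δ : ℝ≥0) (x y : ℕ), x ≤ y →
    pr P (eventAt Ω (t + Δ) {y}) (eventAt Ω t {x}) = pr P (eventAt Ω Δ {y}) (eventAt Ω 0 {x})

/-- The transition probabilities of `P` are Poisson distributed with rate `r`. -/
def HasPoissonTransitions (P : domain Ω → ℝ) (r : ℝ≥0) : Prop :=
  ∀ (t Δ : ℝ≥0) (u : Finset ℝ≥0) (xu : u → ℕ) (x y : ℕ), (∀ s ∈ u, s < t) →
    Admissible u xu x →
    pr P (eventAt Ω (t + Δ) {y}) (cond Ω u xu t x) =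
      if x ≤ y then Real.exp (-(r * Δ : ℝ)) * (r * Δ : ℝ) ^ (y - x) / ((y - x).factorial : ℝ)
      else 0

end CountingProcess

/-!
A full conditional probability that extends a Poisson process is used throughout, so that Bayes'
rule may be applied to arbitrary events.

*The rate.* For a Poisson process, `p_n(t) = P(X_t = n | X_0 = 0)` is a convolution semigroup of
subprobabilities on `ℕ`, and the homogeneity conditions express all transition probabilities by it
(`IsPoissonProcess.isOrderlySemigroup`). Here `p_0` is multiplicative, and orderliness keeps it from
vanishing, so `p_0(t) = exp (-r t)`. The `ℓ¹`-distance between `p(t)` and the Poisson distribution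
with mean `r t` is subadditive in `t`, because both are convolution semigroups, and it is `o(t)`,
because the weights of `0` agree and those of `2, 3, …` are `o(t)`. A subadditive function that is
`o(t)` is zero (`IsOrderlySemigroup.exists_eq_poissonWeight`).

*Existence.* A finitely additive probability, completed on its null events by an arbitrary full
conditional probability, is a full conditional probability, and such probabilities are closed under
limits along ultrafilters. The only point that needs care is to give positive mass to the
conditioning events, which have mass zero if the rate is `0` or if `X_0 > 0`. So for every finite
set of time points take a chain with independent Poisson increments, with the rate `r + ε`, and with
a Poisson initial value of mean `ε` (`exists_poissonMass`): all non-decreasing tuples then have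
positive probability. The limit along finer time sets and `ε → 0` has the rate `r` and starts at `0`
(`exists_isPoissonExtension`).

*Uniqueness.* By Bayes' rule the transition probabilities determine the finite-dimensional
probabilities given a past. As the values up to time `t` are bounded by `X_t`, and `X_t` has a
countably additive distribution given the past, they determine the probabilities of all events of
the field (`IsPoissonExtension.eq_on_domain`).

*Orderliness* of a process with Poisson transitions follows from `1 - e^{-m}(1 + m) ≤ m²`.
-/

namespace CountingProcess

/-! ### Full conditional probabilities -/

namespace IsFullCondProb

variable {S : Type*} {Q : Set S → Set S → ℝ}

theorem apply_empty (hQ : IsFullCondProb Q) {C : Set S} (hC : C.Nonempty) : Q ∅ C = 0 := by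
  have h := hQ.additive ∅ ∅ C hC (inter_self _)
  rw [union_self] at h
  linarith

theorem apply_inter_self (hQ : IsFullCondProb Q) {C : Set S} (hC : C.Nonempty) (A : Set S) :
    Q (A ∩ C) C = Q A C := by
  have h := hQ.bayes A C C hC hC (by rwa [inter_self])
  rw [h, inter_self, hQ.eq_one C C hC subset_rfl, mul_one]

theorem eq_zero (hQ : IsFullCondProb Q) {A C : Set S} (hC : C.Nonempty) (h : A ∩ C = ∅) :
    Q A C = 0 := by
  rw [← hQ.apply_inter_self hC, h, hQ.apply_empty hC]

theorem add_compl (hQ : IsFullCondProb Q) {C : Set S} (hC : C.Nonempty) (A : Set S) :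
    Q A C + Q Aᶜ C = 1 := by
  rw [← hQ.additive _ _ _ hC (inter_compl_self A), union_compl_self,
    hQ.eq_one _ _ hC (subset_univ _)]

theorem inter_add_diff (hQ : IsFullCondProb Q) {C : Set S} (hC : C.Nonempty) (A B : Set S) :
    Q (A ∩ B) C + Q (A \ B) C = Q A C := by
  rw [← hQ.additive _ _ _ hC, inter_union_sdiff]
  exact disjoint_iff_inter_eq_empty.1 disjoint_inf_sdiff

theorem mono (hQ : IsFullCondProb Q) {A B C : Set S} (hC : C.Nonempty) (h : A ⊆ B) :
    Q A C ≤ Q B C := by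
  rw [← hQ.inter_add_diff hC B A, inter_eq_self_of_subset_right h]
  exact le_add_of_nonneg_right (hQ.nonneg _ _ hC)

theorem le_one (hQ : IsFullCondProb Q) {C : Set S} (hC : C.Nonempty) (A : Set S) : Q A C ≤ 1 := by
  rw [← hQ.add_compl hC A]
  exact le_add_of_nonneg_right (hQ.nonneg _ _ hC)

theorem biUnion_finset (hQ : IsFullCondProb Q) {C : Set S} (hC : C.Nonempty) {ι : Type*}
    (s : Finset ι) (A : ι → Set S) (hd : (s : Set ι).PairwiseDisjoint A) :
    Q (⋃ i ∈ s, A i) C = ∑ i ∈ s, Q (A i) C := by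
  classical
  induction s using Finset.induction_on with
  | empty => simp [hQ.apply_empty hC]
  | insert a s ha ih =>
    rw [Finset.set_biUnion_insert, Finset.sum_insert ha, hQ.additive _ _ _ hC,
      ih (hd.subset (by simp))]
    rw [← disjoint_iff_inter_eq_empty, disjoint_iUnion₂_right]
    intro i hi
    exact hd (by simp) (by simp [hi]) (by rintro rfl; exact ha hi)

/-- Conditioning on a further event that holds almost surely changes nothing. -/
theorem eq_of_apply_eq_one (hQ : IsFullCondProb Q) {C D : Set S} (hDC : D ⊆ C)
    (hD : D.Nonempty) (h : Q D C = 1) (A : Set S) : Q A C = Q A D := by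
  have hC := hD.mono hDC
  have h0 : Q (A \ D) C = 0 := by
    have h1 := hQ.add_compl hC D
    have h2 := hQ.mono (A := A \ D) (B := Dᶜ) hC fun _ hx => hx.2
    have h3 := hQ.nonneg (A \ D) C hC
    linarith
  rw [← hQ.inter_add_diff hC A D, h0, add_zero,
    hQ.bayes A C D hC hD (by rwa [inter_eq_self_of_subset_left hDC]),
    inter_eq_self_of_subset_left hDC, h, mul_one]

end IsFullCondProb

/-- Every set carries a full conditional probability: fix a well-order and let all the mass of a
conditioning event sit at its least element. -/
theorem exists_isFullCondProb (S : Type*) : ∃ Q : Set S → Set S → ℝ, IsFullCondProb Q := by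
  classical
  have wf : WellFounded (WellOrderingRel (α := S)) := IsWellFounded.wf
  refine ⟨fun A C => if h : C.Nonempty then (if wf.min C h ∈ A then 1 else 0) else 0,
    ?_, ?_, ?_, ?_⟩
  · intro A C hC
    simp only [hC, dite_true]
    split_ifs <;> norm_num
  · intro A C hC h
    simp only [hC, dite_true, if_pos (h (wf.min_mem C hC))]
  · intro A B C hC h
    simp only [hC, dite_true, mem_union]
    have h' : ¬ (wf.min C hC ∈ A ∧ wf.min C hC ∈ B) := fun hx => by
      have : wf.min C hC ∈ A ∩ B := hx
      rw [h] at this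
      exact this
    by_cases h1 : wf.min C hC ∈ A <;> by_cases h2 : wf.min C hC ∈ B <;> simp_all
  · intro A C D hC hD hDC
    simp only [hC, hDC, dite_true]
    by_cases h : wf.min C hC ∈ D
    · have h1 : wf.min (D ∩ C) hDC = wf.min C hC := by
        have ha := wf.not_lt_min C (wf.min_mem (D ∩ C) hDC).2
        have hb := wf.not_lt_min (D ∩ C) (x := wf.min C hC) ⟨h, wf.min_mem C hC⟩
        rcases trichotomous_of (WellOrderingRel (α := S)) (wf.min (D ∩ C) hDC) (wf.min C hC)
          with h | h | h
        · exact absurd h ha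
        · exact h
        · exact absurd h hb
      simp [h1, h]
    · simp [h]

/-- A finitely additive `m` determines a full conditional probability in which conditioning on an
event of positive mass is division by its mass; the null events are conditioned on by means of an
arbitrary full conditional probability. -/
theorem exists_isFullCondProb_of_additive {S : Type*} (m : Set S → ℝ) (h0 : ∀ A, 0 ≤ m A)
    (hadd : ∀ A B, A ∩ B = ∅ → m (A ∪ B) = m A + m B) :
    ∃ Q : Set S → Set S → ℝ, IsFullCondProb Q ∧
      ∀ A C, 0 < m C → Q A C = m (A ∩ C) / m C := by
  classical
  obtain ⟨Q₀, hQ₀⟩ := exists_isFullCondProb S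
  have hmono : ∀ A B, A ⊆ B → m A ≤ m B := fun A B h => by
    have := hadd A (B \ A) (by simp)
    rw [union_sdiff_cancel h] at this
    linarith [h0 (B \ A)]
  have hnull : ∀ {A B}, A ⊆ B → ¬ 0 < m B → m A = 0 := fun h hB =>
    le_antisymm ((hmono _ _ h).trans (not_lt.1 hB)) (h0 _)
  refine ⟨fun A C => if 0 < m C then m (A ∩ C) / m C else Q₀ A C, ⟨?_, ?_, ?_, ?_⟩,
    fun A C h => if_pos h⟩
  · intro A C hC
    split_ifs
    · exact div_nonneg (h0 _) (h0 _)
    · exact hQ₀.nonneg A C hC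
  · intro A C hC h
    split_ifs with hm
    · rw [inter_eq_self_of_subset_right h, div_self hm.ne']
    · exact hQ₀.eq_one A C hC h
  · intro A B C hC h
    split_ifs
    · rw [union_inter_distrib_right, hadd, add_div]
      rw [← inter_inter_distrib_right, h, empty_inter]
    · exact hQ₀.additive A B C hC h
  · intro A C D hC hD hDC
    by_cases hm : 0 < m C
    · by_cases hm' : 0 < m (D ∩ C)
      · rw [if_pos hm, if_pos hm', if_pos hm, inter_assoc]
        field_simp
      · rw [if_pos hm, if_pos hm, hnull subset_rfl hm', inter_assoc,
          hnull inter_subset_right hm']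
        simp
    · have hm' : ¬ 0 < m (D ∩ C) := fun h => hm (h.trans_le (hmono _ _ inter_subset_right))
      rw [if_neg hm, if_neg hm, if_neg hm']
      exact hQ₀.bayes A C D hC hD hDC

/-- The full conditional probabilities are closed under pointwise limits along an ultrafilter, and
by compactness of the unit interval these limits exist. -/
theorem exists_isFullCondProb_tendsto {S ι : Type*} (U : Ultrafilter ι)
    (Q : ι → Set S → Set S → ℝ) (hQ : ∀ i, IsFullCondProb (Q i)) :
    ∃ R : Set S → Set S → ℝ, IsFullCondProb R ∧
      ∀ A C, C.Nonempty → Tendsto (fun i => Q i A C) U (𝓝 (R A C)) := by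
  have hlim : ∀ A C : Set S, ∃ r : ℝ, C.Nonempty → Tendsto (fun i => Q i A C) U (𝓝 r) := by
    intro A C
    by_cases hC : C.Nonempty
    · obtain ⟨r, -, hr⟩ := (isCompact_Icc (a := (0 : ℝ)) (b := 1)).ultrafilter_le_nhds
        (U.map fun i => Q i A C) (by
          rw [le_principal_iff, Ultrafilter.coe_map, mem_map]
          exact Eventually.of_forall fun i => ⟨(hQ i).nonneg A C hC, (hQ i).le_one hC A⟩)
      exact ⟨r, fun _ => hr⟩
    · exact ⟨0, fun h => absurd h hC⟩
  choose R hR using hlim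
  refine ⟨R, ⟨?_, ?_, ?_, ?_⟩, hR⟩
  · intro A C hC
    exact ge_of_tendsto' (hR A C hC) fun i => (hQ i).nonneg A C hC
  · intro A C hC h
    refine tendsto_nhds_unique (hR A C hC) ?_
    simp only [(hQ _).eq_one A C hC h]
    exact tendsto_const_nhds
  · intro A B C hC h
    refine tendsto_nhds_unique (hR (A ∪ B) C hC) ?_
    simp only [(hQ _).additive A B C hC h]
    exact (hR A C hC).add (hR B C hC)
  · intro A C D hC hD hDC
    refine tendsto_nhds_unique (hR (A ∩ D) C hC) ?_
    simp only [(hQ _).bayes A C D hC hD hDC]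
    exact (hR A (D ∩ C) hDC).mul (hR D C hC)

/-! ### Sums of independent Poisson variables -/

/-- The probability `ψ_m(k)` of the value `k` under the Poisson distribution with mean `m`. -/
noncomputable def poissonWeight (m : ℝ) (k : ℕ) : ℝ :=
  Real.exp (-m) * m ^ k / (k.factorial : ℝ)

section

open MeasureTheory ProbabilityTheory

/-- The law of a sequence of independent Poisson variables with means `a 0, a 1, …`. -/
noncomputable def poissonSequence (a : ℕ → ℝ≥0) : Measure (ℕ → ℕ) :=
  Measure.infinitePi fun j => poissonMeasure (a j)

instance (a : ℕ → ℝ≥0) : IsProbabilityMeasure (poissonSequence a) := by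
  unfold poissonSequence; infer_instance

theorem iIndepFun_poissonSequence (a : ℕ → ℝ≥0) :
    iIndepFun (fun (j : ℕ) (y : ℕ → ℕ) => y j) (poissonSequence a) :=
  iIndepFun_infinitePi (X := fun _ k => k) fun _ => measurable_id

theorem poissonSequence_real_pos {a : ℕ → ℝ≥0} (ha : ∀ j, 0 < a j) (n : ℕ) (z : ℕ → ℕ) :
    0 < (poissonSequence a).real {y | ∀ j < n, y j = z j} := by
  have h : {y : ℕ → ℕ | ∀ j < n, y j = z j} = (Finset.range n : Set ℕ).pi fun j => {z j} := by
    ext y; simp [Set.mem_pi]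
  rw [h, measureReal_def, poissonSequence, Measure.infinitePi_pi _ (by simp), ENNReal.toReal_prod]
  exact Finset.prod_pos fun j _ => poissonMeasure_real_singleton_pos _ (ha j)

theorem hasLaw_sum_poissonSequence (a : ℕ → ℝ≥0) {k l : ℕ} (h : k ≤ l) :
    HasLaw (fun y : ℕ → ℕ => ∑ j ∈ Finset.Ico k l, y j)
      (poissonMeasure (∑ j ∈ Finset.Ico k l, a j)) (poissonSequence a) := by
  induction l, h using Nat.le_induction with
  | base =>
    simp only [Finset.Ico_self, Finset.sum_empty]
    have h0 : poissonMeasure 0 = Measure.dirac 0 := by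
      refine Measure.ext_of_singleton fun n => ?_
      rw [poissonMeasure_singleton]
      rcases n with _ | n <;> simp
    exact ⟨aemeasurable_const, by rw [Measure.map_const, h0]; simp⟩
  | succ l hl ih =>
    have hind : IndepFun (fun y : ℕ → ℕ => ∑ j ∈ Finset.Ico k l, y j) (fun y : ℕ → ℕ => y l)
        (poissonSequence a) := by
      have := (iIndepFun_poissonSequence a).indepFun_finset (Finset.Ico k l) {l} (by simp)
        (fun j => measurable_pi_apply j)
      have h2 := this.comp (φ := fun z => ∑ j : Finset.Ico k l, z j)
        (ψ := fun z : ({l} : Finset ℕ) → ℕ => z ⟨l, Finset.mem_singleton_self l⟩) (by fun_prop)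
        (measurable_of_countable _)
      convert h2 using 1
      · funext y
        exact (Finset.sum_coe_sort (Finset.Ico k l) y).symm
      · rfl
    have hl' : HasLaw (fun y : ℕ → ℕ => y l) (poissonMeasure (a l)) (poissonSequence a) :=
      ⟨(measurable_pi_apply l).aemeasurable, Measure.infinitePi_map_eval _ l⟩
    have := hind.hasLaw_add_poissonMeasure ih hl'
    rw [Finset.sum_Ico_succ_top hl]
    convert this using 1
    funext y
    rw [Finset.sum_Ico_succ_top hl]; rfl

/-- The sum of a later block of variables is independent of the earlier ones. -/
theorem poissonSequence_real_inter (a : ℕ → ℝ≥0) {k l : ℕ} (h : k ≤ l) (E : Set (ℕ → ℕ))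
    (hE : ∀ y y' : ℕ → ℕ, (∀ j < k, y j = y' j) → y ∈ E → y' ∈ E) (d : ℕ) :
    (poissonSequence a).real ({y | ∑ j ∈ Finset.Ico k l, y j = d} ∩ E) =
      (poissonSequence a).real E * poissonWeight (∑ j ∈ Finset.Ico k l, (a j : ℝ)) d := by
  have hind := (iIndepFun_poissonSequence a).indepFun_finset (Finset.range k) (Finset.Ico k l)
    (by rw [Finset.range_eq_Ico]; exact Finset.Ico_disjoint_Ico_consecutive 0 k l)
    (fun j => measurable_pi_apply j)
  have h2 := hind.comp (φ := id) (ψ := fun z => ∑ j : Finset.Ico k l, z j)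
    measurable_id (by fun_prop)
  have hE' : (id ∘ fun (y : ℕ → ℕ) (i : Finset.range k) => y i) ⁻¹'
      ((fun (y : ℕ → ℕ) (i : Finset.range k) => y i) '' E) = E := by
    refine Subset.antisymm ?_ (fun y hy => ⟨y, hy, rfl⟩)
    rintro y ⟨y', hy', he⟩
    exact hE y' y (fun j hj => congrFun he ⟨j, Finset.mem_range.2 hj⟩) hy'
  have h3 := h2.measure_inter_preimage_eq_mul
    ((fun (y : ℕ → ℕ) (i : Finset.range k) => y i) '' E) {d}
    (Set.to_countable _).measurableSet (measurableSet_singleton d)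
  have hs : ((fun z : Finset.Ico k l → ℕ => ∑ j, z j) ∘ fun (y : ℕ → ℕ) (i : Finset.Ico k l) => y i)
      ⁻¹' {d} = {y | ∑ j ∈ Finset.Ico k l, y j = d} := by
    ext y
    simp only [mem_preimage, Function.comp, mem_singleton_iff, mem_ofPred_eq]
    rw [Finset.sum_coe_sort (Finset.Ico k l) y]
  rw [hE', hs] at h3
  have hlaw := (hasLaw_sum_poissonSequence a h)
  have h4 : (poissonSequence a) {y | ∑ j ∈ Finset.Ico k l, y j = d} =
      poissonMeasure (∑ j ∈ Finset.Ico k l, a j) {d} := by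
    rw [← hlaw.map_eq, Measure.map_apply (by fun_prop) (measurableSet_singleton d)]
    rfl
  rw [inter_comm, measureReal_def, h3, ENNReal.toReal_mul, h4, ← measureReal_def,
    ← measureReal_def, poissonMeasure_real_singleton, poissonWeight]
  push_cast
  rfl

end

variable {Ω : Set (ℝ≥0 → ℕ)}

/-! ### Cylinder events -/

/-- The event that the path takes the values `z s` at the time points `s ∈ w`. The values of `z`
outside `w` play no role; indexing by all time points avoids dependent types when `w` varies. -/
def cyl (Ω : Set (ℝ≥0 → ℕ)) (w : Finset ℝ≥0) (z : ℝ≥0 → ℕ) : Set Ω := {ω | ∀ s ∈ w, ω.1 s = z s}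

theorem IsPathSpace.monotone (hΩ : IsPathSpace Ω) (ω : Ω) : Monotone ω.1 := by
  intro a b hab
  have h := hΩ.le_add ω.1 ω.2 a (b - a)
  rwa [add_tsub_cancel_of_le hab] at h

theorem IsPathSpace.nonempty (hΩ : IsPathSpace Ω) : Nonempty Ω := by
  obtain ⟨ω, hω, -⟩ := hΩ.exists_path {0} (by simp) (fun _ => 0) (fun _ _ _ => le_rfl)
  exact ⟨⟨ω, hω⟩⟩

theorem history_eq_cyl {u : Finset ℝ≥0} {x : u → ℕ} {z : ℝ≥0 → ℕ} (h : ∀ s : u, z s = x s) :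
    history Ω u x = cyl Ω u z := by
  ext ω
  simp only [history, finitary, cyl, mem_ofPred_eq, mem_singleton_iff]
  refine ⟨fun hω s hs => ?_, fun hω => funext fun s => ?_⟩
  · rw [h ⟨s, hs⟩, ← hω]
  · rw [hω s s.2, h]

theorem exists_history_eq_cyl (u : Finset ℝ≥0) (x : u → ℕ) :
    ∃ z : ℝ≥0 → ℕ, history Ω u x = cyl Ω u z := by
  classical
  refine ⟨fun s => if h : s ∈ u then x ⟨s, h⟩ else 0, history_eq_cyl fun s => ?_⟩
  simp

theorem IsPathSpace.history_nonempty (hΩ : IsPathSpace Ω) {u : Finset ℝ≥0} {x : u → ℕ}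
    (hx : x ∈ States u) : (history Ω u x).Nonempty := by
  rcases u.eq_empty_or_nonempty with rfl | hu
  · obtain ⟨ω⟩ := hΩ.nonempty
    exact ⟨ω, funext fun s => absurd s.2 (Finset.notMem_empty _)⟩
  · obtain ⟨ω, hω, h⟩ := hΩ.exists_path u hu x hx
    exact ⟨⟨ω, hω⟩, funext h⟩

theorem IsPathSpace.nonempty_of_mem_domain (hΩ : IsPathSpace Ω) {d : Set Ω × Set Ω}
    (hd : d ∈ domain Ω) : d.2.Nonempty := by
  obtain ⟨u, x, hx, -, h⟩ := hd
  rw [h]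
  exact hΩ.history_nonempty hx

/-- The conditioning events of the transition probabilities are cylinder events. -/
theorem exists_cond_eq_cyl {u : Finset ℝ≥0} {t : ℝ≥0} (hu : ∀ s ∈ u, s < t) (xu : u → ℕ) (x : ℕ) :
    ∃ z : ℝ≥0 → ℕ, z t = x ∧ cond Ω u xu t x = cyl Ω (insert t u) z := by
  classical
  have ht : t ∉ u := fun h => lt_irrefl _ (hu t h)
  obtain ⟨z, hz⟩ := exists_history_eq_cyl (Ω := Ω) u xu
  refine ⟨Function.update z t x, by simp, ?_⟩
  rw [cond, hz]
  ext ω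
  simp only [cyl, eventAt, mem_inter_iff, mem_ofPred_eq, mem_singleton_iff,
    Finset.forall_mem_insert, Function.update_self]
  rw [and_comm]
  refine and_congr_right fun _ => forall₂_congr fun s hs => ?_
  rw [Function.update_of_ne (by rintro rfl; exact ht hs)]

theorem cond_nonempty (hΩ : IsPathSpace Ω) {u : Finset ℝ≥0} {xu : u → ℕ} {t : ℝ≥0} {x : ℕ}
    (hu : ∀ s ∈ u, s < t) (hx : Admissible u xu x) : (cond Ω u xu t x).Nonempty :=
  hΩ.nonempty_of_mem_domain (cond_mem_domain hΩ hu hx le_rfl univ)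

/-! ### Poisson chains on finitely many time points -/

theorem exists_strictMono_eq_image_range (T : Finset ℝ≥0) :
    ∃ (σ : ℕ → ℝ≥0) (n : ℕ), StrictMono σ ∧ T = (Finset.range n).image σ := by
  induction T using Finset.induction_on_max with
  | empty => exact ⟨fun k => k, 0, Nat.strictMono_cast, by simp⟩
  | insert t T ht ih =>
    obtain ⟨σ, n, hσ, rfl⟩ := ih
    have ht' : ∀ k < n, σ k < t := fun k hk =>
      ht _ (Finset.mem_image_of_mem σ (Finset.mem_range.2 hk))
    refine ⟨fun k => if k < n then σ k else t + ((k - n : ℕ) : ℝ≥0), n + 1,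
      strictMono_nat_of_lt_succ fun k => ?_, ?_⟩
    · by_cases h1 : k + 1 < n
      · rw [if_pos h1, if_pos (by omega)]
        exact hσ (Nat.lt_succ_self k)
      · by_cases h2 : k < n
        · rw [if_neg h1, if_pos h2]
          exact (ht' k h2).trans_le (le_add_of_nonneg_right zero_le)
        · rw [if_neg h1, if_neg h2]
          exact add_lt_add_of_le_of_lt le_rfl (Nat.cast_lt.2 (by omega))
    · rw [Finset.range_add_one, Finset.image_insert]
      congr 1
      · simp
      · refine Finset.image_congr fun k hk => ?_
        simp only [Finset.coe_range, mem_Iio] at hk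
        simp [hk]

/-- For a finite set `T` of time points there is a finitely additive probability under which the
values at the points of `T` have independent Poisson increments, the value at time `0` being Poisson
distributed with a mean `η`. Since `η` and the rate are positive, every event `(X_w = z)` with
`w ⊆ T` that contains a path has positive mass. -/
theorem exists_poissonMass (hΩ : IsPathSpace Ω) (T : Finset ℝ≥0) (hT : 0 ∈ T) {η r : ℝ≥0}
    (hη : 0 < η) (hr : 0 < r) :
    ∃ m : Set Ω → ℝ, (∀ A, 0 ≤ m A) ∧ (∀ A B, A ∩ B = ∅ → m (A ∪ B) = m A + m B) ∧
      m univ = 1 ∧ m (eventAt Ω 0 {0}) = Real.exp (-η) ∧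
      (∀ w ⊆ T, ∀ z, (cyl Ω w z).Nonempty → 0 < m (cyl Ω w z)) ∧
      (∀ w ⊆ T, ∀ z, ∀ t ∈ w, (∀ s ∈ w, s ≤ t) → ∀ Δ, t + Δ ∈ T → ∀ d,
        m (eventAt Ω (t + Δ) {z t + d} ∩ cyl Ω w z) =
          m (cyl Ω w z) * poissonWeight (r * Δ) d) := by
  classical
  obtain ⟨σ, n, hσ, hTσ⟩ := exists_strictMono_eq_image_range T
  have hmemT : ∀ {s}, s ∈ T → ∃ k < n, σ k = s := fun {s} hs => by
    rw [hTσ] at hs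
    simpa using hs
  obtain ⟨hn, hσ0⟩ : 0 < n ∧ σ 0 = 0 := by
    obtain ⟨k, hk, h⟩ := hmemT hT
    exact ⟨by omega, le_antisymm (h ▸ hσ.monotone (Nat.zero_le k)) zero_le⟩
  -- the value at time `s` is the sum of the increments up to time `s`
  let X : (ℕ → ℕ) → ℝ≥0 → ℕ := fun y s => ∑ j ∈ (Finset.range n).filter (fun j => σ j ≤ s), y j
  have hXσ : ∀ y, ∀ k < n, X y (σ k) = ∑ j ∈ Finset.range (k + 1), y j := by
    intro y k hk
    refine Finset.sum_congr ?_ fun _ _ => rfl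
    ext j
    simp only [Finset.mem_filter, Finset.mem_range, hσ.le_iff_le]
    omega
  have hXmono : ∀ y, Monotone (X y) := fun y a b hab =>
    Finset.sum_le_sum_of_subset fun j hj => by
      simp only [Finset.mem_filter] at hj ⊢
      exact ⟨hj.1, hj.2.trans hab⟩
  -- a path is chosen as a function of its values on `T` alone: there are only countably many such
  -- tuples of values, so no question of measurability arises
  have hpath : ∀ x : T → ℕ, ∃ ω : Ω, x ∈ States T → ∀ s : T, ω.1 s = x s := by
    intro x
    by_cases hx : x ∈ States T
    · obtain ⟨ω, hω, h⟩ := hΩ.exists_path T ⟨0, hT⟩ x hx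
      exact ⟨⟨ω, hω⟩, fun _ => h⟩
    · exact ⟨hΩ.nonempty.some, fun h => absurd h hx⟩
  choose g hg using hpath
  let V : (ℕ → ℕ) → T → ℕ := fun y s => X y s
  have hV : Measurable V := measurable_pi_lambda _ fun s =>
    Finset.measurable_sum _ fun j _ => measurable_pi_apply j
  have hmeas : ∀ A : Set Ω, MeasurableSet {y | g (V y) ∈ A} := fun A =>
    hV (Set.to_countable {x | g x ∈ A}).measurableSet
  let a : ℕ → ℝ≥0 := fun j => Nat.casesOn j η fun i => r * (σ (i + 1) - σ i)
  have ha : ∀ j, 0 < a j := by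
    intro j
    cases j with
    | zero => exact hη
    | succ i => exact mul_pos hr (tsub_pos_of_lt (hσ (Nat.lt_succ_self i)))
  have hcyl : ∀ w ⊆ T, ∀ z, {y | g (V y) ∈ cyl Ω w z} = {y | ∀ s ∈ w, X y s = z s} := by
    intro w hw z
    ext y
    refine forall₂_congr fun s hs => ?_
    rw [hg (V y) (fun p q h => hXmono y h) ⟨s, hw hs⟩]
  have hevent : ∀ s ∈ T, ∀ k, {y | g (V y) ∈ eventAt Ω s {k}} = {y | X y s = k} := by
    intro s hs k
    ext y
    show (g (V y)).1 s = k ↔ _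
    rw [hg (V y) (fun p q h => hXmono y h) ⟨s, hs⟩]
    rfl
  refine ⟨fun A => (poissonSequence a).real {y | g (V y) ∈ A},
    fun A => MeasureTheory.measureReal_nonneg, ?_, ?_, ?_, ?_, ?_⟩
  · intro A B h
    have hd : Disjoint {y | g (V y) ∈ A} {y | g (V y) ∈ B} :=
      disjoint_left.2 fun y hA hB => (h ▸ (⟨hA, hB⟩ : g (V y) ∈ A ∩ B) : g (V y) ∈ (∅ : Set Ω))
    exact MeasureTheory.measureReal_union hd (hmeas B)
  · simp
  · have h := poissonSequence_real_inter a (Nat.zero_le 1) univ (fun _ _ _ _ => trivial) 0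
    rw [inter_univ] at h
    simp only [hevent 0 hT]
    have h0 : ∀ y, X y 0 = ∑ j ∈ Finset.Ico 0 1, y j := fun y => by
      have := hXσ y 0 hn
      rw [hσ0] at this
      simpa using this
    simp only [h0, h]
    simp [poissonWeight, a]
  · rintro w hw z ⟨ω, hω⟩
    -- the increments of a path of the event
    let y₀ : ℕ → ℕ := fun j => Nat.casesOn j (ω.1 (σ 0)) fun i => ω.1 (σ (i + 1)) - ω.1 (σ i)
    have hy₀ : ∀ k, ∑ j ∈ Finset.range (k + 1), y₀ j = ω.1 (σ k) := by
      intro k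
      induction k with
      | zero => simp [y₀]
      | succ k ih =>
        rw [Finset.sum_range_succ, ih]
        exact add_tsub_cancel_of_le (hΩ.monotone ω (hσ (Nat.lt_succ_self k)).le)
    simp only [hcyl w hw z]
    refine (poissonSequence_real_pos ha n y₀).trans_le (MeasureTheory.measureReal_mono ?_)
    intro y hy s hs
    obtain ⟨k, hk, rfl⟩ := hmemT (hw hs)
    rw [hXσ y k hk, ← hω _ hs, ← hy₀ k]
    refine Finset.sum_congr rfl fun j hj => hy j ?_
    rw [Finset.mem_range] at hj
    omega
  · intro w hw z t ht hmax Δ hΔ d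
    obtain ⟨i, hi, rfl⟩ := hmemT (hw ht)
    obtain ⟨l, hl, hlΔ⟩ := hmemT hΔ
    have hil : i ≤ l := hσ.le_iff_le.1 (hlΔ ▸ le_add_of_nonneg_right zero_le)
    have hset : {y | g (V y) ∈ eventAt Ω (σ i + Δ) {z (σ i) + d} ∩ cyl Ω w z} =
        {y | ∑ j ∈ Finset.Ico (i + 1) (l + 1), y j = d} ∩ {y | ∀ s ∈ w, X y s = z s} := by
      rw [← hcyl w hw z]
      have h1 := hevent _ hΔ (z (σ i) + d)
      have h2 : ∀ y, g (V y) ∈ cyl Ω w z → X y (σ i) = z (σ i) := fun y hy => by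
        have : y ∈ {y | g (V y) ∈ cyl Ω w z} := hy
        rw [hcyl w hw z] at this
        exact this _ ht
      ext y
      have h3 : g (V y) ∈ eventAt Ω (σ i + Δ) {z (σ i) + d} ↔ X y (σ i + Δ) = z (σ i) + d :=
        Set.ext_iff.1 h1 y
      simp only [mem_ofPred_eq, mem_inter_iff, h3]
      refine and_congr_left fun hy => ?_
      rw [← h2 y hy, ← hlΔ, hXσ y i hi, hXσ y l hl,
        ← Finset.sum_range_add_sum_Ico _ (Nat.succ_le_succ hil)]
      exact Nat.add_left_cancel_iff
    simp only [hset, hcyl w hw z]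
    rw [poissonSequence_real_inter a (Nat.succ_le_succ hil)]
    · congr 2
      have hsum : ∀ l, i ≤ l →
          ∑ j ∈ Finset.Ico (i + 1) (l + 1), NNReal.toReal (a j) = r * ((σ l : ℝ) - σ i) := by
        intro l hl
        induction l, hl using Nat.le_induction with
        | base => simp
        | succ l hl ih =>
          rw [Finset.sum_Ico_succ_top (by omega), ih]
          have : NNReal.toReal (a (l + 1)) = r * ((σ (l + 1) : ℝ) - σ l) := by
            simp only [a, NNReal.coe_mul, NNReal.coe_sub (hσ (Nat.lt_succ_self l)).le]
          rw [this]
          ring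
      rw [hsum l hil, hlΔ]
      push_cast
      ring
    · intro y y' h hy s hs
      obtain ⟨k, hk, rfl⟩ := hmemT (hw hs)
      rw [← hy _ hs, hXσ y k hk, hXσ y' k hk]
      have hki := hσ.le_iff_le.1 (hmax _ hs)
      refine Finset.sum_congr rfl fun j hj => (h j ?_).symm
      rw [Finset.mem_range] at hj
      omega

/-! ### The Poisson weights -/

theorem poissonWeight_nonneg {m : ℝ} (hm : 0 ≤ m) (k : ℕ) : 0 ≤ poissonWeight m k := by
  unfold poissonWeight; positivity

theorem continuous_poissonWeight (k : ℕ) : Continuous fun m => poissonWeight m k := by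
  unfold poissonWeight; fun_prop

theorem hasSum_poissonWeight {m : ℝ} (hm : 0 ≤ m) : HasSum (poissonWeight m) 1 :=
  ProbabilityTheory.hasSum_one_poissonMeasure ⟨m, hm⟩

/-! ### Extensions with Poisson transitions -/

/-- A full conditional probability on the space of paths that starts at `0` and has Poisson
transition probabilities with rate `r`. -/
structure IsPoissonExtension (Q : Set Ω → Set Ω → ℝ) (r : ℝ≥0) : Prop extends
    IsFullCondProb Q where
  start : Q (eventAt Ω 0 {0}) univ = 1
  transition : ∀ (t Δ : ℝ≥0) (u : Finset ℝ≥0) (xu : u → ℕ) (x y : ℕ), (∀ s ∈ u, s < t) →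
    Admissible u xu x →
    Q (eventAt Ω (t + Δ) {y}) (cond Ω u xu t x) =
      if x ≤ y then poissonWeight (r * Δ) (y - x) else 0

theorem pr_eq {P : domain Ω → ℝ} {Q : Set Ω → Set Ω → ℝ}
    (h : ∀ d : domain Ω, Q d.1.1 d.1.2 = P d) {A C : Set Ω} (hd : (A, C) ∈ domain Ω) :
    pr P A C = Q A C := by
  rw [pr, dif_pos hd, ← h]

theorem isPoissonExtension_iff (hΩ : IsPathSpace Ω) {P : domain Ω → ℝ} {Q : Set Ω → Set Ω → ℝ}
    (hQ : IsFullCondProb Q) (h : ∀ d : domain Ω, Q d.1.1 d.1.2 = P d) (r : ℝ≥0) :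
    IsPoissonExtension Q r ↔ StartsAtZero P ∧ HasPoissonTransitions P r := by
  have h0 : pr P (eventAt Ω 0 {0}) univ = Q (eventAt Ω 0 {0}) univ :=
    pr_eq h (univ_mem_domain hΩ 0 {0})
  constructor
  · intro hQr
    refine ⟨h0.trans hQr.start, fun t Δ u xu x y hu hx => ?_⟩
    rw [pr_eq h (cond_mem_domain hΩ hu hx le_self_add _)]
    exact hQr.transition t Δ u xu x y hu hx
  · rintro ⟨h1, h2⟩
    refine ⟨hQ, h0.symm.trans h1, fun t Δ u xu x y hu hx => ?_⟩
    rw [← pr_eq h (cond_mem_domain hΩ hu hx le_self_add _)]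
    exact h2 t Δ u xu x y hu hx

theorem eventAt_inter_cond_eq_empty (hΩ : IsPathSpace Ω) {u : Finset ℝ≥0} {xu : u → ℕ}
    {t s : ℝ≥0} (hts : t ≤ s) {x : ℕ} {B : Set ℕ} (hB : ∀ y ∈ B, y < x) :
    eventAt Ω s B ∩ cond Ω u xu t x = ∅ := by
  refine eq_empty_of_forall_notMem ?_
  rintro ω ⟨h1, -, h2⟩
  have h3 := hΩ.monotone ω hts
  have h4 : ω.1 t = x := h2
  have h5 := hB _ h1
  omega

/-- Existence: on the events of finitely many time points the Poisson chains with slightly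
increased rate and slightly random initial value give full conditional probabilities, and a limit of
these along an ultrafilter has the desired transition probabilities. -/
theorem exists_isPoissonExtension (hΩ : IsPathSpace Ω) (r : ℝ≥0) :
    ∃ Q : Set Ω → Set Ω → ℝ, IsPoissonExtension Q r := by
  classical
  let e : ℕ → ℝ≥0 := fun n => 1 / ((n : ℝ≥0) + 1)
  have he : ∀ n, 0 < e n := fun n => by positivity
  have hlim : Tendsto (fun i : Finset ℝ≥0 × ℕ => (e i.2 : ℝ)) atTop (𝓝 0) := by
    have h1 : Tendsto (fun n : ℕ => (e n : ℝ)) atTop (𝓝 0) := by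
      simpa [e] using tendsto_one_div_add_atTop_nhds_zero_nat (𝕜 := ℝ)
    rw [← prod_atTop_atTop_eq]
    exact h1.comp tendsto_snd
  have hQ : ∀ i : Finset ℝ≥0 × ℕ, ∃ Q : Set Ω → Set Ω → ℝ, IsFullCondProb Q ∧
      Q (eventAt Ω 0 {0}) univ = Real.exp (-(e i.2)) ∧
      ∀ (w : Finset ℝ≥0) (z : ℝ≥0 → ℕ), w ⊆ i.1 → (cyl Ω w z).Nonempty → ∀ t ∈ w,
        (∀ s ∈ w, s ≤ t) → ∀ Δ, t + Δ ∈ i.1 → ∀ d,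
        Q (eventAt Ω (t + Δ) {z t + d}) (cyl Ω w z) = poissonWeight ((r + e i.2) * Δ) d := by
    rintro ⟨T, n⟩
    obtain ⟨m, h0, hadd, h1, hstart, hpos, htrans⟩ := exists_poissonMass hΩ (insert 0 T) (by simp)
      (he n) (add_pos_of_nonneg_of_pos zero_le (he n) : 0 < r + e n)
    obtain ⟨Q, hQ, hQm⟩ := exists_isFullCondProb_of_additive m h0 hadd
    refine ⟨Q, hQ, ?_, ?_⟩
    · rw [hQm _ _ (by rw [h1]; norm_num), h1, inter_univ, hstart, div_one]
    · intro w z hw hne t ht hmax Δ hΔ d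
      have hw' := hw.trans (Finset.subset_insert 0 T)
      have hp := hpos w hw' z hne
      rw [hQm _ _ hp, htrans w hw' z t ht hmax Δ (Finset.mem_insert_of_mem hΔ) d,
        mul_div_cancel_left₀ _ hp.ne', NNReal.coe_add]
  choose Q hfull hstart htrans using hQ
  let U : Ultrafilter (Finset ℝ≥0 × ℕ) := Ultrafilter.of atTop
  have hU : (U : Filter (Finset ℝ≥0 × ℕ)) ≤ atTop := Ultrafilter.of_le _
  obtain ⟨R, hR, hRlim⟩ := exists_isFullCondProb_tendsto U Q hfull
  refine ⟨R, hR, ?_, ?_⟩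
  · obtain ⟨ω⟩ := hΩ.nonempty
    refine tendsto_nhds_unique (hRlim _ _ ⟨ω, mem_univ _⟩) ?_
    simp only [hstart]
    have := (Real.continuous_exp.tendsto _).comp (hlim.mono_left hU).neg
    simpa [Function.comp_def] using this
  · intro t Δ u xu x y hu hx
    have hne := cond_nonempty hΩ hu hx
    split_ifs with hxy
    · obtain ⟨z, hz, hcyl⟩ := exists_cond_eq_cyl (Ω := Ω) hu xu x
      refine tendsto_nhds_unique (hRlim _ _ hne) ?_
      have hev : ∀ᶠ i : Finset ℝ≥0 × ℕ in U, poissonWeight ((r + e i.2) * Δ) (y - x) =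
          Q i (eventAt Ω (t + Δ) {y}) (cond Ω u xu t x) := by
        refine hU (mem_of_superset (mem_atTop (insert (t + Δ) (insert t u), 0)) ?_)
        intro i hi
        have hi' : insert (t + Δ) (insert t u) ⊆ i.1 := hi.1
        have h := htrans i (insert t u) z ((Finset.subset_insert _ _).trans hi') (hcyl ▸ hne) t
          (Finset.mem_insert_self _ _) (by
            intro s hs
            rcases Finset.mem_insert.1 hs with rfl | hs
            · exact le_rfl
            · exact (hu s hs).le) Δ (hi' (Finset.mem_insert_self _ _)) (y - x)
        rw [hz, Nat.add_sub_cancel' hxy] at h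
        rw [mem_ofPred_eq, hcyl, h]
      refine Tendsto.congr' hev ?_
      have h1 : Tendsto (fun i : Finset ℝ≥0 × ℕ => ((r : ℝ) + e i.2) * Δ) U (𝓝 ((r + 0) * Δ)) :=
        ((hlim.mono_left hU).const_add _).mul_const _
      rw [add_zero] at h1
      exact ((continuous_poissonWeight (y - x)).tendsto _).comp h1
    · refine hR.eq_zero hne (eventAt_inter_cond_eq_empty hΩ le_self_add ?_)
      rintro _ rfl
      omega

/-! ### Uniqueness -/

theorem IsPoissonExtension.apply_cyl {Q : Set Ω → Set Ω → ℝ} {r : ℝ≥0}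
    (hΩ : IsPathSpace Ω) (hQ : IsPoissonExtension Q r) {w : Finset ℝ≥0} {z : ℝ≥0 → ℕ}
    (hne : (cyl Ω w z).Nonempty) {t s : ℝ≥0} (ht : t ∈ w) (hmax : ∀ p ∈ w, p ≤ t) (hts : t ≤ s)
    (y : ℕ) :
    Q (eventAt Ω s {y}) (cyl Ω w z) =
      if z t ≤ y then poissonWeight (r * (s - t : ℝ≥0)) (y - z t) else 0 := by
  classical
  obtain ⟨ω, hω⟩ := hne
  have h1 : cyl Ω w z = cond Ω (w.erase t) (fun p => z p) t (z t) := by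
    rw [cond, history_eq_cyl (z := z) fun _ => rfl]
    ext ω
    simp only [cyl, eventAt, mem_inter_iff, mem_ofPred_eq, mem_singleton_iff]
    conv_lhs => rw [← Finset.insert_erase ht, Finset.forall_mem_insert]
    rw [and_comm]
  have h2 := hQ.transition t (s - t) (w.erase t) (fun p => z p) (z t) y
    (fun p hp => lt_of_le_of_ne (hmax p (Finset.mem_of_mem_erase hp)) (Finset.ne_of_mem_erase hp))
    ⟨fun p q hpq => by
      show z p ≤ z q
      rw [← hω p (Finset.mem_of_mem_erase p.2), ← hω q (Finset.mem_of_mem_erase q.2)]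
      exact hΩ.monotone ω hpq, fun p => by
      show z p ≤ z t
      rw [← hω p (Finset.mem_of_mem_erase p.2), ← hω t ht]
      exact hΩ.monotone ω (hmax p (Finset.mem_of_mem_erase p.2))⟩
  rwa [add_tsub_cancel_of_le hts, ← h1] at h2

/-- The finite-dimensional distributions given the past are determined by the transitions. -/
theorem IsPoissonExtension.apply_cyl_cyl_eq {Q Q' : Set Ω → Set Ω → ℝ} {r : ℝ≥0}
    (hΩ : IsPathSpace Ω) (hQ : IsPoissonExtension Q r) (hQ' : IsPoissonExtension Q' r)
    {u : Finset ℝ≥0} (hu : u.Nonempty) {z : ℝ≥0 → ℕ} (hne : (cyl Ω u z).Nonempty)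
    (w : Finset ℝ≥0) (hw : ∀ s ∈ w, ∀ p ∈ u, p < s) :
    Q (cyl Ω (u ∪ w) z) (cyl Ω u z) = Q' (cyl Ω (u ∪ w) z) (cyl Ω u z) := by
  classical
  induction w using Finset.induction_on_max with
  | empty =>
    rw [Finset.union_empty, hQ.eq_one _ _ hne subset_rfl, hQ'.eq_one _ _ hne subset_rfl]
  | insert t w ht ih =>
    have ih := ih fun s hs => hw s (Finset.mem_insert_of_mem hs)
    have h1 : cyl Ω (u ∪ insert t w) z = eventAt Ω t {z t} ∩ cyl Ω (u ∪ w) z := by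
      rw [Finset.union_insert]
      ext ω
      simp only [cyl, eventAt, mem_inter_iff, mem_ofPred_eq, mem_singleton_iff,
        Finset.forall_mem_insert]
    rcases (cyl Ω (u ∪ w) z).eq_empty_or_nonempty with he | hne'
    · rw [h1, he, inter_empty, hQ.apply_empty hne, hQ'.apply_empty hne]
    · have h2 : cyl Ω (u ∪ w) z ∩ cyl Ω u z = cyl Ω (u ∪ w) z :=
        inter_eq_self_of_subset_left fun ω hω s hs => hω s (Finset.mem_union_left w hs)
      have hne2 : (cyl Ω (u ∪ w) z ∩ cyl Ω u z).Nonempty := by rwa [h2]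
      have huw : (u ∪ w).Nonempty := hu.mono Finset.subset_union_left
      have hlast : (u ∪ w).max' huw ≤ t := Finset.max'_le _ _ _ fun p hp => by
        rcases Finset.mem_union.1 hp with hp | hp
        · exact (hw t (Finset.mem_insert_self _ _) p hp).le
        · exact (ht p hp).le
      have hmem := (u ∪ w).max'_mem huw
      have hmax : ∀ p ∈ u ∪ w, p ≤ (u ∪ w).max' huw := fun p hp => Finset.le_max' _ p hp
      rw [h1, hQ.bayes _ _ _ hne hne' hne2, hQ'.bayes _ _ _ hne hne' hne2, h2, ih,
        hQ.apply_cyl hΩ hne' hmem hmax hlast, hQ'.apply_cyl hΩ hne' hmem hmax hlast]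

/-- An event of the field of `u` depends only on the values at `u` and at finitely many later time
points. -/
theorem exists_finset_of_mem_field {u : Finset ℝ≥0} {A : Set Ω} (hA : A ∈ field Ω u) :
    ∃ w : Finset ℝ≥0, (∀ s ∈ w, ∀ p ∈ u, p < s) ∧
      ∀ ω ω' : Ω, (∀ s ∈ u ∪ w, ω.1 s = ω'.1 s) → (ω ∈ A ↔ ω' ∈ A) := by
  classical
  induction hA with
  | base A hA =>
    obtain ⟨v, B, -, hv, rfl⟩ := hA
    refine ⟨v \ u, fun s hs p hp => ?_, fun ω ω' h => ?_⟩
    · rw [Finset.mem_sdiff] at hs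
      refine lt_of_le_of_ne ((hv s hs.1).resolve_left hs.2 p hp) ?_
      rintro rfl
      exact hs.2 hp
    · have : (fun s : v => ω.1 s) = fun s : v => ω'.1 s := funext fun s => h s (by
        rw [Finset.union_sdiff_self_eq_union]
        exact Finset.mem_union_right _ s.2)
      simp only [finitary, mem_ofPred_eq, this]
  | empty => exact ⟨∅, by simp, by simp⟩
  | compl A _ ih =>
    obtain ⟨w, hw, h⟩ := ih
    exact ⟨w, hw, fun ω ω' hω => not_congr (h ω ω' hω)⟩
  | union A B _ _ ihA ihB =>
    obtain ⟨w, hw, h⟩ := ihA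
    obtain ⟨w', hw', h'⟩ := ihB
    refine ⟨w ∪ w', fun s hs => ?_, fun ω ω' hω => or_congr (h ω ω' ?_) (h' ω ω' ?_)⟩
    · rcases Finset.mem_union.1 hs with hs | hs
      · exact hw s hs
      · exact hw' s hs
    · exact fun s hs => hω s (Finset.union_subset_union_right Finset.subset_union_left hs)
    · exact fun s hs => hω s (Finset.union_subset_union_right Finset.subset_union_right hs)

/-- The values at a fixed time point do not escape to infinity. -/
theorem IsPoissonExtension.tendsto_eventAt_compl_Iio {Q : Set Ω → Set Ω → ℝ} {r : ℝ≥0}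
    (hΩ : IsPathSpace Ω) (hQ : IsPoissonExtension Q r) {w : Finset ℝ≥0} {z : ℝ≥0 → ℕ}
    (hne : (cyl Ω w z).Nonempty) {t s : ℝ≥0} (ht : t ∈ w) (hmax : ∀ p ∈ w, p ≤ t) (hts : t ≤ s) :
    Tendsto (fun N : ℕ => Q (eventAt Ω s (Iio N))ᶜ (cyl Ω w z)) atTop (𝓝 0) := by
  rw [← tendsto_add_atTop_iff_nat (z t)]
  have h1 : ∀ N : ℕ, Q (eventAt Ω s (Iio (N + z t)))ᶜ (cyl Ω w z) =
      1 - ∑ k ∈ Finset.range N, poissonWeight (r * (s - t : ℝ≥0)) k := by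
    intro N
    have h2 : eventAt Ω s (Iio (N + z t)) =
        ⋃ y ∈ Finset.range (N + z t), eventAt Ω s {y} := by
      ext ω
      simp [eventAt]
    have h3 : Q (eventAt Ω s (Iio (N + z t))) (cyl Ω w z) =
        ∑ k ∈ Finset.range N, poissonWeight (r * (s - t : ℝ≥0)) k := by
      rw [h2, hQ.biUnion_finset hne]
      · simp only [hQ.apply_cyl hΩ hne ht hmax hts]
        rw [add_comm N, Finset.sum_range_add, Finset.sum_eq_zero, zero_add]
        · simp
        · intro y hy
          rw [Finset.mem_range] at hy
          exact if_neg (by omega)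
      · intro y _ y' _ hyy
        refine disjoint_left.2 fun ω h h' => hyy ?_
        have ha : ω.1 s = y := h
        have hb : ω.1 s = y' := h'
        exact ha.symm.trans hb
    rw [← h3]
    linarith [hQ.add_compl hne (eventAt Ω s (Iio (N + z t)))]
  simp only [h1]
  have := (hasSum_poissonWeight
    (m := r * (s - t : ℝ≥0)) (by positivity)).tendsto_sum_nat.const_sub 1
  simpa using this

/-- Given a non-empty past, all probabilities of the field are determined: by countable additivity
of the Poisson distribution they are limits of finite sums of finite-dimensional ones. -/
theorem IsPoissonExtension.apply_cyl_eq {Q Q' : Set Ω → Set Ω → ℝ} {r : ℝ≥0}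
    (hΩ : IsPathSpace Ω) (hQ : IsPoissonExtension Q r) (hQ' : IsPoissonExtension Q' r)
    {u : Finset ℝ≥0} (hu : u.Nonempty) {z : ℝ≥0 → ℕ} (hne : (cyl Ω u z).Nonempty)
    {A : Set Ω} (hA : A ∈ field Ω u) : Q A (cyl Ω u z) = Q' A (cyl Ω u z) := by
  classical
  obtain ⟨w, hw, hAw⟩ := exists_finset_of_mem_field hA
  have huw : (u ∪ w).Nonempty := hu.mono Finset.subset_union_left
  let s := (u ∪ w).max' huw
  have hs : ∀ p ∈ u ∪ w, p ≤ s := fun p hp => Finset.le_max' _ p hp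
  let ext : (↥(u ∪ w) → ℕ) → ℝ≥0 → ℕ := fun x p => if h : p ∈ u ∪ w then x ⟨p, h⟩ else 0
  have hext : ∀ x (p : ↥(u ∪ w)), ext x p = x p := fun x p => dif_pos p.2
  have hcyl : ∀ x : ℝ≥0 → ℕ, Q (cyl Ω (u ∪ w) x) (cyl Ω u z) =
      Q' (cyl Ω (u ∪ w) x) (cyl Ω u z) := by
    intro x
    by_cases hx : ∀ p ∈ u, x p = z p
    · have h1 : cyl Ω u z = cyl Ω u x := by
        ext ω
        exact forall₂_congr fun p hp => by rw [hx p hp]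
      rw [h1] at hne ⊢
      exact hQ.apply_cyl_cyl_eq hΩ hQ' hu hne w hw
    · have h1 : cyl Ω (u ∪ w) x ∩ cyl Ω u z = ∅ := by
        refine eq_empty_of_forall_notMem fun ω hω => hx fun p hp => ?_
        rw [← hω.1 p (Finset.mem_union_left w hp), hω.2 p hp]
      rw [hQ.eq_zero hne h1, hQ'.eq_zero hne h1]
  -- the event `A` with the values bounded by `N` is a finite union of cylinder events
  have hfin : ∀ N : ℕ, Q (A ∩ eventAt Ω s (Iio N)) (cyl Ω u z) =
      Q' (A ∩ eventAt Ω s (Iio N)) (cyl Ω u z) := by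
    intro N
    have h1 : A ∩ eventAt Ω s (Iio N) =
        ⋃ x ∈ (Fintype.piFinset fun _ : ↥(u ∪ w) => Finset.range N).filter
          (fun x => (cyl Ω (u ∪ w) (ext x) ∩ A).Nonempty), cyl Ω (u ∪ w) (ext x) := by
      ext ω
      simp only [mem_inter_iff, mem_iUnion, Finset.mem_filter, Fintype.mem_piFinset,
        Finset.mem_range, exists_prop]
      constructor
      · rintro ⟨h1, h2⟩
        have h3 : ω ∈ cyl Ω (u ∪ w) (ext fun p => ω.1 p) := fun p hp =>
          (hext (fun p => ω.1 p) ⟨p, hp⟩).symm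
        exact ⟨fun p => ω.1 p, ⟨fun p => (hΩ.monotone ω (hs p p.2)).trans_lt h2, ω, h3, h1⟩, h3⟩
      · rintro ⟨x, ⟨h1, ω', h2, h3⟩, h4⟩
        refine ⟨(hAw ω ω' fun p hp => (h4 p hp).trans (h2 p hp).symm).2 h3, ?_⟩
        have h5 := h4 s ((u ∪ w).max'_mem huw)
        have h6 := h1 ⟨s, (u ∪ w).max'_mem huw⟩
        rw [← hext x] at h6
        exact h5.trans_lt h6
    have hd : (((Fintype.piFinset fun _ : ↥(u ∪ w) => Finset.range N).filter
          (fun x => (cyl Ω (u ∪ w) (ext x) ∩ A).Nonempty) : Finset _) : Set _).PairwiseDisjoint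
          fun x => cyl Ω (u ∪ w) (ext x) := by
      intro x _ x' _ hxx
      refine disjoint_left.2 fun ω h h' => hxx (funext fun p => ?_)
      rw [← hext x p, ← hext x' p, ← h p p.2, ← h' p p.2]
    rw [h1, hQ.biUnion_finset hne _ _ hd, hQ'.biUnion_finset hne _ _ hd]
    exact Finset.sum_congr rfl fun x _ => hcyl _
  have hlim : ∀ {R : Set Ω → Set Ω → ℝ}, IsPoissonExtension R r →
      Tendsto (fun N : ℕ => R (A ∩ eventAt Ω s (Iio N)) (cyl Ω u z)) atTop
        (𝓝 (R A (cyl Ω u z))) := by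
    intro R hR
    have h1 := hR.tendsto_eventAt_compl_Iio hΩ hne (u.max'_mem hu)
      (fun p hp => Finset.le_max' u p hp)
      (hs _ (Finset.mem_union_left w (u.max'_mem hu)))
    have h2 := squeeze_zero (fun N : ℕ => hR.nonneg (A \ eventAt Ω s (Iio N)) _ hne)
      (fun N => hR.mono hne fun ω hω => hω.2) h1
    have h3 := h2.const_sub (R A (cyl Ω u z))
    rw [sub_zero] at h3
    refine h3.congr fun N => ?_
    rw [← hR.inter_add_diff hne A (eventAt Ω s (Iio N)), add_sub_cancel_right]
  refine tendsto_nhds_unique (hlim hQ) ?_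
  simp only [hfin]
  exact hlim hQ'

/-- The values on the domain are determined. Without a past the process may be assumed to be at `0`
at time `0`, which reduces this case to the non-empty past `X_0 = 0`. -/
theorem IsPoissonExtension.eq_on_domain {Q Q' : Set Ω → Set Ω → ℝ} {r : ℝ≥0}
    (hΩ : IsPathSpace Ω) (hQ : IsPoissonExtension Q r) (hQ' : IsPoissonExtension Q' r)
    {d : Set Ω × Set Ω} (hd : d ∈ domain Ω) : Q d.1 d.2 = Q' d.1 d.2 := by
  have hne := hΩ.nonempty_of_mem_domain hd
  obtain ⟨A, C⟩ := d
  obtain ⟨u, x, hx, hA, hC⟩ := hd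
  dsimp only at hA hC hne ⊢
  rcases u.eq_empty_or_nonempty with rfl | hu
  · have hCuniv : C = univ := hC.trans
      (eq_univ_of_forall fun _ => funext fun s => absurd s.2 (Finset.notMem_empty _))
    rw [hCuniv] at hne ⊢
    have h0 : eventAt Ω 0 {0} = cyl Ω {0} fun _ => 0 := by
      ext ω
      simp [eventAt, cyl]
    have hne0 : (eventAt Ω 0 {0}).Nonempty := by
      rw [nonempty_iff_ne_empty]
      intro h
      have := hQ.start
      rw [h, hQ.apply_empty hne] at this
      exact zero_ne_one this
    rw [hQ.eq_of_apply_eq_one (subset_univ _) hne0 hQ.start,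
      hQ'.eq_of_apply_eq_one (subset_univ _) hne0 hQ'.start]
    rw [h0] at hne0 ⊢
    refine hQ.apply_cyl_eq hΩ hQ' (by simp) hne0 (MeasureTheory.generateSetAlgebra_mono ?_ hA)
    rintro _ ⟨v, B, hB, -, rfl⟩
    exact ⟨v, B, hB, fun t _ => Or.inr (by simp), rfl⟩
  · obtain ⟨z, hz⟩ := exists_history_eq_cyl (Ω := Ω) u x
    rw [hC, hz] at hne ⊢
    exact hQ.apply_cyl_eq hΩ hQ' hu hne hA

/-! ### Processes with Poisson transitions are Poisson processes -/

theorem one_sub_poissonWeight_le (m : ℝ) (hm : 0 ≤ m) :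
    1 - poissonWeight m 0 - poissonWeight m 1 ≤ m ^ 2 := by
  have h1 := Real.add_one_le_exp (-m)
  simp only [poissonWeight, pow_zero, mul_one, Nat.factorial_zero, Nat.cast_one, div_one, pow_one,
    Nat.factorial_one]
  nlinarith

theorem IsFullCondProb.apply_Ici_add_two {Q : Set Ω → Set Ω → ℝ} (hΩ : IsPathSpace Ω)
    (hQ : IsFullCondProb Q) {t s : ℝ≥0} (hts : t ≤ s) {u : Finset ℝ≥0} {xu : u → ℕ} {x : ℕ}
    (hu : ∀ p ∈ u, p < t) (hx : Admissible u xu x) :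
    Q (eventAt Ω s (Ici (x + 2))) (cond Ω u xu t x) =
      1 - Q (eventAt Ω s {x}) (cond Ω u xu t x) - Q (eventAt Ω s {x + 1}) (cond Ω u xu t x) := by
  have hne := cond_nonempty hΩ hu hx
  have h0 : Q (eventAt Ω s (Iio x)) (cond Ω u xu t x) = 0 :=
    hQ.eq_zero hne (eventAt_inter_cond_eq_empty hΩ hts fun y hy => hy)
  have h1 : (eventAt Ω s (Ici (x + 2)))ᶜ =
      (eventAt Ω s (Iio x) ∪ eventAt Ω s {x}) ∪ eventAt Ω s {x + 1} := by
    ext ω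
    simp only [eventAt, mem_compl_iff, mem_union, mem_ofPred_eq, mem_Ici, mem_Iio,
      mem_singleton_iff]
    omega
  have h2 := hQ.add_compl hne (eventAt Ω s (Ici (x + 2)))
  rw [h1, hQ.additive _ _ _ hne, hQ.additive _ _ _ hne, h0] at h2
  · linarith
  · ext ω
    simp only [eventAt, mem_inter_iff, mem_ofPred_eq, mem_Iio, mem_singleton_iff,
      mem_empty_iff_false, iff_false]
    omega
  · ext ω
    simp only [eventAt, mem_inter_iff, mem_union, mem_ofPred_eq, mem_Iio, mem_singleton_iff,
      mem_empty_iff_false, iff_false]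
    omega

theorem admissible_empty (x : ℕ) : Admissible ∅ (fun _ => 0) x :=
  ⟨fun _ _ _ => le_rfl, fun _ => Nat.zero_le x⟩

theorem HasPoissonTransitions.pr_eventAt {P : domain Ω → ℝ} {r : ℝ≥0}
    (h : HasPoissonTransitions P r) (t Δ : ℝ≥0) {x y : ℕ} (hxy : x ≤ y) :
    pr P (eventAt Ω (t + Δ) {y}) (eventAt Ω t {x}) = poissonWeight (r * Δ) (y - x) := by
  have h1 := h t Δ ∅ (fun _ => 0) x y (by simp) (admissible_empty x)
  rw [cond_empty, if_pos hxy] at h1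
  exact h1

theorem HasPoissonTransitions.pr_Ici_div_mem_Icc (hΩ : IsPathSpace Ω) {P : domain Ω → ℝ} {r : ℝ≥0}
    (hP : IsCoherent (domain Ω) P) (h : HasPoissonTransitions P r) {t Δ : ℝ≥0} (hΔ : 0 < Δ)
    {u : Finset ℝ≥0} {xu : u → ℕ} {x : ℕ} (hu : ∀ s ∈ u, s < t) (hx : Admissible u xu x) :
    pr P (eventAt Ω (t + Δ) (Ici (x + 2))) (cond Ω u xu t x) / (Δ : ℝ) ∈
      Icc (0 : ℝ) (r ^ 2 * Δ) := by
  obtain ⟨-, Q, hQ, hQP⟩ := hP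
  have hpr : ∀ B : Set ℕ, pr P (eventAt Ω (t + Δ) B) (cond Ω u xu t x) =
      Q (eventAt Ω (t + Δ) B) (cond Ω u xu t x) := fun B =>
    pr_eq hQP (cond_mem_domain hΩ hu hx le_self_add B)
  have h0 := h t Δ u xu x x hu hx
  have h1 := h t Δ u xu x (x + 1) hu hx
  rw [if_pos le_rfl, hpr, Nat.sub_self] at h0
  rw [if_pos (Nat.le_succ x), hpr, Nat.add_sub_cancel_left] at h1
  have hle := one_sub_poissonWeight_le (r * Δ) (by positivity)
  have hΔ' : (0 : ℝ) < Δ := hΔ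
  refine ⟨div_nonneg ?_ hΔ'.le, ?_⟩
  · rw [hpr]
    exact hQ.nonneg _ _ (cond_nonempty hΩ hu hx)
  · rw [div_le_iff₀ hΔ', hpr, hQ.apply_Ici_add_two hΩ le_self_add hu hx, h0, h1]
    refine hle.trans_eq ?_
    ring

theorem HasPoissonTransitions.isPoissonProcess_of_startsAtZero (hΩ : IsPathSpace Ω)
    {P : domain Ω → ℝ} {r : ℝ≥0} (hP : IsCoherent (domain Ω) P) (h0 : StartsAtZero P)
    (h : HasPoissonTransitions P r) : IsPoissonProcess P := by
  have hlim : Tendsto (fun Δ : ℝ≥0 => (r : ℝ) ^ 2 * Δ) (𝓝[>] 0) (𝓝 0) := by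
    have : Tendsto (fun Δ : ℝ≥0 => (r : ℝ) ^ 2 * Δ) (𝓝 0) (𝓝 ((r : ℝ) ^ 2 * (0 : ℝ≥0))) :=
      Continuous.tendsto (by fun_prop) 0
    rw [NNReal.coe_zero, mul_zero] at this
    exact this.mono_left nhdsWithin_le_nhds
  have hpos : ∀ᶠ Δ : ℝ≥0 in 𝓝[>] 0, 0 < Δ := self_mem_nhdsWithin
  refine ⟨⟨hP, h0, fun t u xu x hu hx => ⟨?_, fun ht => ?_⟩⟩, ?_, ?_, ?_⟩
  · refine squeeze_zero' ?_ ?_ hlim <;> filter_upwards [hpos] with Δ hΔ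
    · exact (h.pr_Ici_div_mem_Icc hΩ hP hΔ hu hx).1
    · exact (h.pr_Ici_div_mem_Icc hΩ hP hΔ hu hx).2
  · -- for small `Δ` the time point `t - Δ` still follows those of `u`
    have hu' : ∀ᶠ Δ : ℝ≥0 in 𝓝[>] 0, ∀ s ∈ u, s < t - Δ := by
      rw [Finset.eventually_all]
      intro s hs
      have : ∀ᶠ Δ : ℝ≥0 in 𝓝 0, Δ < t - s := gt_mem_nhds (tsub_pos_of_lt (hu s hs))
      filter_upwards [nhdsWithin_le_nhds this] with Δ hΔ
      exact lt_tsub_comm.1 hΔ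
    have ht' : ∀ᶠ Δ : ℝ≥0 in 𝓝[>] 0, Δ < t := nhdsWithin_le_nhds (gt_mem_nhds ht)
    refine squeeze_zero' ?_ ?_ hlim <;> filter_upwards [hpos, hu', ht'] with Δ hΔ hΔu hΔt
    · have := (h.pr_Ici_div_mem_Icc hΩ hP hΔ hΔu hx).1
      rwa [tsub_add_cancel_of_le hΔt.le] at this
    · have := (h.pr_Ici_div_mem_Icc hΩ hP hΔ hΔu hx).2
      rwa [tsub_add_cancel_of_le hΔt.le] at this
  · intro t Δ u xu x y hu hx hxy
    rw [h.pr_eventAt t Δ hxy, h t Δ u xu x y hu hx, if_pos hxy, poissonWeight]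
  · intro t Δ x y hxy
    rw [h.pr_eventAt t Δ hxy, h.pr_eventAt t Δ (Nat.zero_le _), Nat.sub_zero]
  · intro t Δ x y hxy
    have := h.pr_eventAt 0 Δ hxy
    rw [zero_add] at this
    rw [h.pr_eventAt t Δ hxy, this]

/-! ### Orderly convolution semigroups on the counts -/

theorem poissonWeight_add (m m' : ℝ) (n : ℕ) : poissonWeight (m + m') n =
    ∑ k ∈ Finset.range (n + 1), poissonWeight m k * poissonWeight m' (n - k) := by
  unfold poissonWeight
  rw [neg_add, Real.exp_add, add_pow, Finset.mul_sum, Finset.sum_div]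
  refine Finset.sum_congr rfl fun k hk => ?_
  have hk' : k ≤ n := Nat.lt_succ_iff.1 (Finset.mem_range.1 hk)
  have h : (n.choose k : ℝ) * k.factorial * (n - k).factorial = n.factorial := by
    exact_mod_cast Nat.choose_mul_factorial_mul_factorial hk'
  have hn : (n.factorial : ℝ) ≠ 0 := by positivity
  rw [div_eq_iff hn, ← h]
  field_simp

/-- An additive non-negative function on the half-line is linear. -/
theorem eq_mul_of_additive {f : ℝ≥0 → ℝ} (h0 : ∀ t, 0 ≤ f t)
    (hadd : ∀ s t, f (s + t) = f s + f t) (t : ℝ≥0) : f t = f 1 * t := by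
  have hmono : Monotone f := fun a b hab => by
    rw [← add_tsub_cancel_of_le hab, hadd]
    exact le_add_of_nonneg_right (h0 _)
  have hnat : ∀ (n : ℕ) (t : ℝ≥0), f (n * t) = n * f t := by
    intro n t
    induction n with
    | zero =>
      have := hadd 0 0
      simp only [add_zero] at this
      simp only [Nat.cast_zero, zero_mul]
      linarith
    | succ n ih =>
      push_cast
      rw [add_mul, one_mul, hadd, ih]
      ring
  have hbound : ∀ n : ℕ, n * |f t - f 1 * t| ≤ f 1 := by
    intro n
    have h1 := hmono (Nat.floor_le (zero_le : 0 ≤ (n : ℝ≥0) * t))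
    have h2 := hmono (Nat.lt_floor_add_one ((n : ℝ≥0) * t)).le
    rw [hnat, ← mul_one ((⌊(n : ℝ≥0) * t⌋₊ : ℕ) : ℝ≥0), hnat] at h1
    rw [hnat, hadd, ← mul_one ((⌊(n : ℝ≥0) * t⌋₊ : ℕ) : ℝ≥0), hnat] at h2
    have h3 : ((⌊(n : ℝ≥0) * t⌋₊ : ℕ) : ℝ) ≤ n * t := by
      exact_mod_cast Nat.floor_le (zero_le : 0 ≤ (n : ℝ≥0) * t)
    have h4 : (n : ℝ) * t ≤ (⌊(n : ℝ≥0) * t⌋₊ : ℕ) + 1 := by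
      exact_mod_cast (Nat.lt_floor_add_one ((n : ℝ≥0) * t)).le
    have h5 := mul_le_mul_of_nonneg_left h3 (h0 1)
    have h6 := mul_le_mul_of_nonneg_left h4 (h0 1)
    rw [← abs_of_nonneg (Nat.cast_nonneg (α := ℝ) n), ← abs_mul, abs_le]
    constructor <;> nlinarith
  by_contra hne
  have hpos : 0 < |f t - f 1 * t| := abs_pos.2 (sub_ne_zero.2 hne)
  obtain ⟨n, hn⟩ := exists_nat_gt (f 1 / |f t - f 1 * t|)
  rw [div_lt_iff₀ hpos] at hn
  exact absurd (hbound n) (not_le.2 hn)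

theorem sum_convolution_le {a b : ℕ → ℝ} (ha : ∀ k, 0 ≤ a k) (hb : ∀ k, 0 ≤ b k) (M : ℕ) :
    ∑ n ∈ Finset.range M, ∑ k ∈ Finset.range (n + 1), a k * b (n - k) ≤
      (∑ k ∈ Finset.range M, a k) * ∑ k ∈ Finset.range M, b k := by
  rw [Finset.sum_range_diag_flip M fun k j => a k * b j, Finset.sum_mul]
  refine Finset.sum_le_sum fun k _ => ?_
  rw [← Finset.mul_sum]
  refine mul_le_mul_of_nonneg_left
    (Finset.sum_le_sum_of_subset_of_nonneg ?_ fun j _ _ => hb j) (ha k)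
  exact Finset.range_mono (Nat.sub_le _ _)

theorem sum_range_poissonWeight_le_one {m : ℝ} (hm : 0 ≤ m) (N : ℕ) :
    ∑ n ∈ Finset.range N, poissonWeight m n ≤ 1 :=
  sum_le_hasSum _ (fun k _ => poissonWeight_nonneg hm k) (hasSum_poissonWeight hm)

/-- A convolution semigroup of subprobabilities on the counts, as formed by the transition
probabilities of a Poisson process, with the property that two or more events in a short time are of
smaller order than its length. -/
structure IsOrderlySemigroup (p : ℕ → ℝ≥0 → ℝ) : Prop where
  nonneg : ∀ n t, 0 ≤ p n t
  sum_le_one : ∀ N t, ∑ n ∈ Finset.range N, p n t ≤ 1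
  zero_zero : p 0 0 = 1
  add : ∀ n s t, p n (s + t) = ∑ k ∈ Finset.range (n + 1), p k s * p (n - k) t
  orderly : Tendsto (fun Δ : ℝ≥0 => (1 - p 0 Δ - p 1 Δ) / (Δ : ℝ)) (𝓝[>] 0) (𝓝 0)

namespace IsOrderlySemigroup

variable {p : ℕ → ℝ≥0 → ℝ}

theorem zero_add (hp : IsOrderlySemigroup p) (s t : ℝ≥0) : p 0 (s + t) = p 0 s * p 0 t := by
  simp [hp.add]

theorem zero_le_one (hp : IsOrderlySemigroup p) (t : ℝ≥0) : p 0 t ≤ 1 := by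
  simpa using hp.sum_le_one 1 t

/-- If the probability of no event vanished at some time, it would vanish at all positive times, and
by the semigroup property so would that of one event, contradicting orderliness. -/
theorem zero_pos (hp : IsOrderlySemigroup p) (t : ℝ≥0) : 0 < p 0 t := by
  refine lt_of_le_of_ne (hp.nonneg 0 t) fun h => ?_
  have hanti : Antitone (p 0) := fun a b hab => by
    rw [← add_tsub_cancel_of_le hab, hp.zero_add]
    exact mul_le_of_le_one_right (hp.nonneg _ _) (hp.zero_le_one _)
  have hpow : ∀ (n : ℕ) (s : ℝ≥0), p 0 (n * s) = p 0 s ^ n := by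
    intro n s
    induction n with
    | zero => simp [hp.zero_zero]
    | succ n ih =>
      push_cast
      rw [add_mul, one_mul, hp.zero_add, ih, pow_succ]
  have h0 : ∀ s, 0 < s → p 0 s = 0 := by
    intro s hs
    obtain ⟨n, hn⟩ := exists_nat_gt (t / s)
    have h1 : p 0 (n * s) ≤ 0 := by
      rw [h]
      exact hanti ((div_lt_iff₀ hs).1 hn).le
    rw [hpow] at h1
    exact eq_zero_of_pow_eq_zero (le_antisymm h1 (pow_nonneg (hp.nonneg 0 s) n))
  have h1 : ∀ s, 0 < s → p 1 s = 0 := by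
    intro s hs
    rw [← add_halves s, hp.add]
    simp [Finset.sum_range_succ, h0 (s / 2) (half_pos hs)]
  have hlt : ∀ᶠ Δ : ℝ≥0 in 𝓝[>] 0, (1 - p 0 Δ - p 1 Δ) / (Δ : ℝ) < 1 :=
    hp.orderly.eventually (gt_mem_nhds zero_lt_one)
  have hsmall : ∀ᶠ Δ : ℝ≥0 in 𝓝[>] 0, Δ < 1 := nhdsWithin_le_nhds (gt_mem_nhds zero_lt_one)
  have hpos : ∀ᶠ Δ : ℝ≥0 in 𝓝[>] 0, 0 < Δ := self_mem_nhdsWithin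
  obtain ⟨Δ, h2, h3, h4⟩ := (hlt.and (hsmall.and hpos)).exists
  have h4' : (0 : ℝ) < Δ := h4
  have h3' : (Δ : ℝ) < 1 := h3
  rw [h0 Δ h4, h1 Δ h4, div_lt_iff₀ h4'] at h2
  linarith

theorem exists_rate (hp : IsOrderlySemigroup p) :
    ∃ r : ℝ≥0, ∀ t : ℝ≥0, p 0 t = poissonWeight (r * t) 0 := by
  have h0 : ∀ t, 0 ≤ -Real.log (p 0 t) := fun t =>
    neg_nonneg.2 (Real.log_nonpos (hp.nonneg 0 t) (hp.zero_le_one t))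
  have h := eq_mul_of_additive h0 fun s t => by
    rw [hp.zero_add, Real.log_mul (hp.zero_pos s).ne' (hp.zero_pos t).ne']
    ring
  refine ⟨⟨_, h0 1⟩, fun t => ?_⟩
  have : poissonWeight (-Real.log (p 0 1) * t) 0 = p 0 t := by
    rw [← h t]
    simp [poissonWeight, Real.exp_log (hp.zero_pos t)]
  exact this.symm

/-- The semigroup consists of Poisson distributions: the distance to the Poisson distribution of the
same rate is subadditive in time and, by orderliness, of smaller order than the time, so it is
zero. -/
theorem exists_eq_poissonWeight (hp : IsOrderlySemigroup p) :
    ∃ r : ℝ≥0, ∀ n (t : ℝ≥0), p n t = poissonWeight (r * t) n := by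
  obtain ⟨r, hr⟩ := hp.exists_rate
  refine ⟨r, ?_⟩
  have hrt : ∀ t : ℝ≥0, 0 ≤ (r * t : ℝ) := fun t => by positivity
  let q : ℕ → ℝ≥0 → ℝ := fun n t => poissonWeight (r * t) n
  have hq0 : ∀ n t, 0 ≤ q n t := fun n t => poissonWeight_nonneg (hrt t) n
  have hq1 : ∀ N t, ∑ n ∈ Finset.range N, q n t ≤ 1 := fun N t =>
    sum_range_poissonWeight_le_one (hrt t) N
  have hqadd : ∀ n s t, q n (s + t) = ∑ k ∈ Finset.range (n + 1), q k s * q (n - k) t := by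
    intro n s t
    simp only [q, ← poissonWeight_add]
    push_cast
    rw [mul_add]
  let D : ℕ → ℝ≥0 → ℝ := fun M t => ∑ n ∈ Finset.range M, |p n t - q n t|
  have hD0 : ∀ M t, 0 ≤ D M t := fun M t => Finset.sum_nonneg fun _ _ => abs_nonneg _
  have hDadd : ∀ M s t, D M (s + t) ≤ D M s + D M t := by
    intro M s t
    have h1 : D M (s + t) ≤ ∑ n ∈ Finset.range M,
        (∑ k ∈ Finset.range (n + 1), |p k s - q k s| * p (n - k) t +
          ∑ k ∈ Finset.range (n + 1), q k s * |p (n - k) t - q (n - k) t|) := by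
      refine Finset.sum_le_sum fun n _ => ?_
      rw [hp.add, hqadd, ← Finset.sum_sub_distrib, ← Finset.sum_add_distrib]
      refine (Finset.abs_sum_le_sum_abs _ _).trans (Finset.sum_le_sum fun k _ => ?_)
      have h : p k s * p (n - k) t - q k s * q (n - k) t =
          (p k s - q k s) * p (n - k) t + q k s * (p (n - k) t - q (n - k) t) := by ring
      rw [h]
      refine (abs_add_le _ _).trans_eq ?_
      rw [abs_mul, abs_mul, abs_of_nonneg (hp.nonneg _ _), abs_of_nonneg (hq0 _ _)]
    rw [Finset.sum_add_distrib] at h1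
    have h2 := sum_convolution_le (a := fun k => |p k s - q k s|) (b := fun k => p k t)
      (fun _ => abs_nonneg _) (fun k => hp.nonneg k t) M
    have h3 := sum_convolution_le (a := fun k => q k s) (b := fun k => |p k t - q k t|)
      (fun k => hq0 k s) (fun _ => abs_nonneg _) M
    have h4 := mul_le_of_le_one_right (hD0 M s) (hp.sum_le_one M t)
    have h5 := mul_le_of_le_one_left (hD0 M t) (hq1 M s)
    exact h1.trans (add_le_add (h2.trans h4) (h3.trans h5))
  -- the weights of `0` agree, and those of `1` differ at most by the weights of `2, 3, …`
  have hDle : ∀ M t, D (M + 2) t ≤ 2 * (1 - p 0 t - p 1 t) + 2 * (r ^ 2 * (t : ℝ) ^ 2) := by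
    intro M t
    have e0 : p 0 t = q 0 t := hr t
    have hP := hp.sum_le_one (M + 2) t
    have hQ := hq1 (M + 2) t
    have hw : 1 - q 0 t - q 1 t ≤ r ^ 2 * (t : ℝ) ^ 2 :=
      (one_sub_poissonWeight_le _ (hrt t)).trans_eq (by ring)
    have hP2 : p 0 t + p 1 t ≤ 1 := by simpa [Finset.sum_range_succ] using hp.sum_le_one 2 t
    have hQ2 : q 0 t + q 1 t ≤ 1 := by simpa [Finset.sum_range_succ] using hq1 2 t
    have htail : ∑ n ∈ Finset.range M, |p (n + 1 + 1) t - q (n + 1 + 1) t| ≤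
        ∑ n ∈ Finset.range M, p (n + 1 + 1) t + ∑ n ∈ Finset.range M, q (n + 1 + 1) t := by
      rw [← Finset.sum_add_distrib]
      refine Finset.sum_le_sum fun n _ => abs_le.2 ⟨?_, ?_⟩ <;>
        linarith [hp.nonneg (n + 1 + 1) t, hq0 (n + 1 + 1) t]
    have hone : |p 1 t - q 1 t| ≤ (1 - p 0 t - p 1 t) + (1 - q 0 t - q 1 t) := by
      rw [abs_le]
      constructor <;> linarith
    rw [Finset.sum_range_succ', Finset.sum_range_succ'] at hP hQ
    simp only [Nat.zero_add] at hP hQ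
    simp only [D]
    rw [Finset.sum_range_succ', Finset.sum_range_succ']
    simp only [Nat.zero_add]
    rw [e0, sub_self, abs_zero] at *
    linarith
  have hDzero : ∀ M t, D (M + 2) t = 0 := by
    intro M t
    refine le_antisymm ?_ (hD0 _ _)
    rcases eq_or_lt_of_le (zero_le : 0 ≤ t) with rfl | ht
    · have h1 := hDle M 0
      rw [hp.zero_zero] at h1
      have h2 := hp.nonneg 1 0
      simp only [NNReal.coe_zero] at h1
      nlinarith
    · have hnat : ∀ (n : ℕ) (s : ℝ≥0), D (M + 2) (((n : ℝ≥0) + 1) * s) ≤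
          ((n : ℝ) + 1) * D (M + 2) s := by
        intro n s
        induction n with
        | zero => simp
        | succ n ih =>
          push_cast
          rw [add_mul _ 1 s, one_mul, add_mul _ 1 (D (M + 2) s), one_mul]
          exact (hDadd _ _ _).trans (add_le_add ih le_rfl)
      -- the distance at time `t` is at most `n` times that at time `s = t / n`, hence at most
      -- `t` times the quotient of the distance at `s` by `s`
      have hlim : Tendsto (fun s : ℝ≥0 => (t : ℝ) *
          (2 * ((1 - p 0 s - p 1 s) / (s : ℝ)) + 2 * (r ^ 2 * (s : ℝ)))) (𝓝[>] 0) (𝓝 0) := by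
        have h1 : Tendsto (fun s : ℝ≥0 => 2 * ((r : ℝ) ^ 2 * (s : ℝ))) (𝓝[>] 0) (𝓝 0) := by
          have : Tendsto (fun s : ℝ≥0 => 2 * ((r : ℝ) ^ 2 * (s : ℝ))) (𝓝 0)
              (𝓝 (2 * ((r : ℝ) ^ 2 * ((0 : ℝ≥0) : ℝ)))) := Continuous.tendsto (by fun_prop) 0
          rw [NNReal.coe_zero, mul_zero, mul_zero] at this
          exact this.mono_left nhdsWithin_le_nhds
        have h2 := ((hp.orderly.const_mul 2).add h1).const_mul (t : ℝ)
        simpa using h2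
      have hseq : Tendsto (fun n : ℕ => t / ((n : ℝ≥0) + 1)) atTop (𝓝[>] 0) := by
        refine tendsto_nhdsWithin_iff.2 ⟨?_, Eventually.of_forall fun n => by
          rw [mem_Ioi]; positivity⟩
        rw [← NNReal.tendsto_coe]
        push_cast
        have := (tendsto_one_div_add_atTop_nhds_zero_nat (𝕜 := ℝ)).const_mul (t : ℝ)
        simpa [div_eq_mul_inv] using this
      refine ge_of_tendsto' (hlim.comp hseq) fun n => ?_
      have hn : (n : ℝ≥0) + 1 ≠ 0 := by positivity
      have hs : (0 : ℝ) < (t / ((n : ℝ≥0) + 1) : ℝ≥0) := by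
        have : 0 < t / ((n : ℝ≥0) + 1) := by positivity
        exact_mod_cast this
      have h1 := hnat n (t / ((n : ℝ≥0) + 1))
      rw [mul_div_cancel₀ _ hn] at h1
      refine h1.trans ?_
      have h2 := hDle M (t / ((n : ℝ≥0) + 1))
      simp only [Function.comp]
      set s : ℝ≥0 := t / ((n : ℝ≥0) + 1) with hsdef
      have h3 : (t : ℝ) = ((n : ℝ) + 1) * s := by
        rw [hsdef]
        push_cast
        field_simp
      rw [h3, mul_assoc]
      refine mul_le_mul_of_nonneg_left (h2.trans_eq ?_) (by positivity)
      field_simp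
  intro n t
  have h1 := hDzero n t
  have h2 := (Finset.sum_eq_zero_iff_of_nonneg fun _ _ => abs_nonneg _).1 h1 n
    (Finset.mem_range.2 (by omega))
  exact sub_eq_zero.1 (abs_eq_zero.1 h2)

end IsOrderlySemigroup

/-! ### The rate of a Poisson process -/

theorem IsPoissonProcess.pr_cond {P : domain Ω → ℝ} (hP : IsPoissonProcess P) (t Δ : ℝ≥0)
    {u : Finset ℝ≥0} {xu : u → ℕ} {x y : ℕ} (hu : ∀ s ∈ u, s < t) (hx : Admissible u xu x)
    (hxy : x ≤ y) :
    pr P (eventAt Ω (t + Δ) {y}) (cond Ω u xu t x) =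
      pr P (eventAt Ω Δ {y - x}) (eventAt Ω 0 {0}) := by
  rw [hP.markov t Δ u xu x y hu hx hxy, hP.state_homogeneous t Δ x y hxy,
    hP.time_homogeneous t Δ 0 (y - x) (Nat.zero_le _)]

/-- The transition probabilities from `0` at time `0` of a Poisson process satisfy the
Chapman-Kolmogorov equations. -/
theorem IsPoissonProcess.isOrderlySemigroup (hΩ : IsPathSpace Ω) {P : domain Ω → ℝ}
    (hP : IsPoissonProcess P) :
    IsOrderlySemigroup fun n t => pr P (eventAt Ω t {n}) (eventAt Ω 0 {0}) := by
  obtain ⟨-, Q, hQ, hQP⟩ := hP.coherent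
  have hcond : cond Ω ∅ (fun _ => 0) 0 0 = eventAt Ω 0 {0} := cond_empty _ _ _
  have hne : (eventAt Ω 0 {0}).Nonempty :=
    hcond ▸ cond_nonempty hΩ (by simp) (admissible_empty 0)
  have hpr : ∀ t B, pr P (eventAt Ω t B) (eventAt Ω 0 {0}) =
      Q (eventAt Ω t B) (eventAt Ω 0 {0}) := fun t B => by
    rw [← hcond]
    exact pr_eq hQP (cond_mem_domain hΩ (by simp) (admissible_empty 0) zero_le B)
  have hzero : pr P (eventAt Ω 0 {0}) (eventAt Ω 0 {0}) = 1 := by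
    rw [hpr]
    exact hQ.eq_one _ _ hne subset_rfl
  have hdisj : ∀ (t : ℝ≥0) (s : Set ℕ), s.PairwiseDisjoint fun k => eventAt Ω t {k} := by
    intro t s k _ k' _ hkk
    refine disjoint_left.2 fun ω h h' => hkk ?_
    have ha : ω.1 t = k := h
    have hb : ω.1 t = k' := h'
    exact ha.symm.trans hb
  refine ⟨fun n t => ?_, fun N t => ?_, hzero, fun n s t => ?_, ?_⟩
  · rw [hpr]
    exact hQ.nonneg _ _ hne
  · simp only [hpr]
    rw [← hQ.biUnion_finset hne _ _ (hdisj t _)]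
    exact hQ.le_one hne _
  · rcases eq_or_lt_of_le (zero_le : 0 ≤ s) with rfl | hs
    · -- at time `0` the present coincides with the conditioning event
      rw [Finset.sum_range_succ', Finset.sum_eq_zero, hzero]
      · simp
      · intro k _
        have h1 : eventAt Ω 0 {k + 1} ∩ eventAt Ω 0 {0} = ∅ :=
          disjoint_iff_inter_eq_empty.1
            (hdisj 0 univ (mem_univ (k + 1)) (mem_univ 0) (Nat.succ_ne_zero k))
        rw [hpr, hQ.eq_zero hne h1, zero_mul]
    · have hu : ∀ p ∈ ({0} : Finset ℝ≥0), p < s := by simpa using hs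
      have hadm : ∀ k, Admissible {0} (fun _ => 0) k := fun k =>
        ⟨fun _ _ _ => le_rfl, fun _ => Nat.zero_le k⟩
      have hck : ∀ k, eventAt Ω s {k} ∩ eventAt Ω 0 {0} = cond Ω {0} (fun _ => 0) s k := by
        intro k
        have : history Ω {0} (fun _ => 0) = eventAt Ω 0 {0} := by
          rw [history_eq_cyl (z := fun _ => 0) fun _ => rfl]
          ext ω
          simp [cyl, eventAt]
        rw [cond, this, inter_comm]
      have hsplit : eventAt Ω (s + t) {n} =
          ⋃ k ∈ Finset.range (n + 1), (eventAt Ω (s + t) {n} ∩ eventAt Ω s {k}) := by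
        ext ω
        simp only [mem_iUnion, Finset.mem_range, exists_prop, mem_inter_iff]
        refine ⟨fun h => ⟨ω.1 s, ?_, h, rfl⟩, fun ⟨_, _, h, _⟩ => h⟩
        have h1 := hΩ.monotone ω (le_self_add : s ≤ s + t)
        have h2 : ω.1 (s + t) = n := h
        omega
      rw [hpr]
      conv_lhs => rw [hsplit]
      rw [hQ.biUnion_finset hne _ _ fun k hk k' hk' h =>
        (hdisj s univ (mem_univ k) (mem_univ k') h).mono inter_subset_right inter_subset_right]
      refine Finset.sum_congr rfl fun k hk => ?_
      have hkn : k ≤ n := Nat.lt_succ_iff.1 (Finset.mem_range.1 hk)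
      have hne2 := cond_nonempty hΩ hu (hadm k)
      have hdom := cond_mem_domain hΩ hu (hadm k) (le_self_add : s ≤ s + t) {n}
      rw [← hP.pr_cond s t hu (hadm k) hkn, pr_eq hQP hdom, hpr, ← hck]
      rw [← hck] at hne2
      rw [hQ.bayes _ _ _ hne (hne2.mono inter_subset_left) hne2, mul_comm]
  · have h1 := (hP.orderly 0 ∅ (fun _ => 0) 0 (by simp) (admissible_empty 0)).1
    refine h1.congr fun Δ => ?_
    have h2 := hQ.apply_Ici_add_two hΩ (zero_le : 0 ≤ Δ) (u := ∅) (xu := fun _ => 0) (x := 0)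
      (by simp) (admissible_empty 0)
    rw [hcond] at h2 ⊢
    rw [_root_.zero_add, hpr, h2, hpr, hpr]

theorem IsPoissonProcess.exists_hasPoissonTransitions (hΩ : IsPathSpace Ω) {P : domain Ω → ℝ}
    (hP : IsPoissonProcess P) : ∃ r : ℝ≥0, HasPoissonTransitions P r := by
  obtain ⟨r, hr⟩ := (hP.isOrderlySemigroup hΩ).exists_eq_poissonWeight
  refine ⟨r, fun t Δ u xu x y hu hx => ?_⟩
  split_ifs with hxy
  · rw [hP.pr_cond t Δ hu hx hxy]
    exact hr (y - x) Δ
  · obtain ⟨-, Q, hQ, hQP⟩ := hP.coherent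
    rw [pr_eq hQP (cond_mem_domain hΩ hu hx le_self_add _)]
    refine hQ.eq_zero (cond_nonempty hΩ hu hx) (eventAt_inter_cond_eq_empty hΩ le_self_add ?_)
    rintro _ rfl
    omega

end CountingProcess

theorem mainTheorem2 (Ω : Set (ℝ≥0 → ℕ)) (hΩ : CountingProcess.IsPathSpace Ω) :
    (∀ P : CountingProcess.domain Ω → ℝ, CountingProcess.IsPoissonProcess P →
      ∃ r : ℝ≥0, CountingProcess.HasPoissonTransitions P r) ∧
    (∀ r : ℝ≥0,
      (∃! P : CountingProcess.domain Ω → ℝ,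
        CountingProcess.IsCoherent (CountingProcess.domain Ω) P ∧
        CountingProcess.StartsAtZero P ∧ CountingProcess.HasPoissonTransitions P r) ∧
      (∀ P : CountingProcess.domain Ω → ℝ,
        CountingProcess.IsCoherent (CountingProcess.domain Ω) P →
        CountingProcess.StartsAtZero P → CountingProcess.HasPoissonTransitions P r →
        CountingProcess.IsPoissonProcess P)) := by
  refine ⟨fun P hP => hP.exists_hasPoissonTransitions hΩ,
    fun r => ⟨?_, fun _ hP h0 h => h.isPoissonProcess_of_startsAtZero hΩ hP h0⟩⟩
  obtain ⟨Q, hQ⟩ := CountingProcess.exists_isPoissonExtension hΩ r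
  refine ⟨fun d => Q d.1.1 d.1.2,
    ⟨⟨fun d hd => hΩ.nonempty_of_mem_domain hd, Q, hQ.toIsFullCondProb, fun _ => rfl⟩,
      (CountingProcess.isPoissonExtension_iff hΩ hQ.toIsFullCondProb (fun _ => rfl) r).1 hQ⟩, ?_⟩
  rintro P ⟨⟨-, Q', hQ', hQP'⟩, h⟩
  have hQr := (CountingProcess.isPoissonExtension_iff hΩ hQ' hQP' r).2 h
  funext d
  rw [← hQP' d]
  exact hQr.eq_on_domain hΩ hQ d.2
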